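/- Conventions. Let $N\ge 1$. A weight matrix is an $N\times N$ matrix $W$ of complex Borel measures on $\mathbb R$ such that $W(\Omega)$ is positive semidefinite for every Borel set $\Omega$, all moments $\int t^n\,dW(t)$ are finite, and $\int P\,dW\,P^*$ is nonsingular for every matrix polynomial $P$ with nonsingular leading coefficient. A (right-hand side) second order differential operator is $D=\partial^2F_2(t)+\partial^1F_1(t)+\partial^0F_0$, with $F_2,F_1,F_0$ matrix polynomials of degrees at most $2,1,0$, acting on matrix polynomials by $PD=P''F_2+P'F_1+PF_0$. It is symmetric with respect to $W$ if $\int (PD)\,dW\,Q^*=\int P\,dW\,(QD)^*$ for all matrix polynomials $P,Q$, and $\Upsilon(D)$ denotes the set of all weight matrices with respect to which $D$ is symmetric. For real $\alpha,\beta>-1$ and $0<k<\beta+1$ let $$W_{\alpha,\beta,k}(t)=t^\alpha(1-t)^\beta\begin{pmatrix}kt^2+\beta-k+1&(\beta-k+1)(1-t)\\(\beta-k+1)(1-t)&(\beta-k+1)(1-t)^2\end{pmatrix}\chi_{(0,1)}(t).$$ (i) For all such $\alpha,\beta,k$ and every real $t_0\ne-\frac1k(\alpha+\beta-k+2)$ there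 exist a second order differential operator $D=D_{\alpha,\beta,k,t_0}$ with real coefficients and $F_2\neq0$, and a real symmetric positive semidefinite $2\times2$ matrix $M(t_0)$ of rank one, such that $D$ is symmetric with respect to $W_{\alpha,\beta,k}$ and $$F_2(t_0)M(t_0)=0,\qquad F_1(t_0)M(t_0)=0,\qquad F_0M(t_0)=M(t_0)F_0^*.$$ Moreover $D$ is symmetric with respect to $\gamma W_{\alpha,\beta,k}+\zeta\delta_{t_0}M(t_0)$ for all $\gamma>0$, $\zeta\ge0$, and $$\Upsilon(D)=\{\gamma W_{\alpha,\beta,k}+\zeta\delta_{t_0}M(t_0):\ \gamma>0,\ \zeta\ge0\}.$$ (ii) Let $\alpha=\beta=0$, $k=1/2$, $t_0\in\mathbb R\setminus\{-3\}$, fix a sign $\pm$, and let $$\varphi=\varphi^\pm(t_0)=\frac{2-t_0\pm\sqrt{2t_0^2-2t_0+1}}{t_0+3},\qquad q=\frac{1-t_0}{\varphi},$$ where $q:=2$ if $\varphi=0$ (which happens only for $\varphi^-$ at $t_0=1$). Then all the conclusions of (i) hold for $$F_2(t)=\begin{pmatrix}(1-t)(-t_0+t(2t_0-3))+q\,t(1-t)&2t+t_0-2t_0t-t_0t^2\\-t_0(1-t)^2&(t-1)(t-t_0)+q\,t(1-t)\end{pmatrix},$$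 $$F_1(t)=\begin{pmatrix}12t-10+8t_0(1-t)-q(4t-3)&9-t-4t_0(t+2)-2q\\(1-4t_0)(t-1)&4(t-t_0)-q(4t-1)\end{pmatrix},$$ $$F_0=\begin{pmatrix}\frac{q(1+2\varphi)}2&-t_0-3+\frac q2\\-t_0+\frac q2&-\frac{q(1+2\varphi)}2\end{pmatrix},\qquad M(t_0)=\begin{pmatrix}1&\varphi\\\varphi&\varphi^2\end{pmatrix}.$$ -/

import Mathlib

open MeasureTheory Polynomial
open scoped ComplexOrder

noncomputable section

namespace MatrixWeight

/-- An `N × N` matrix of finite complex Borel measures on the real line. -/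
abbrev MatrixMeasure (N : ℕ) : Type := Matrix (Fin N) (Fin N) (ComplexMeasure ℝ)

/-- The numerical matrix `W(Ω)`. -/
def massOf {N : ℕ} (W : MatrixMeasure N) (Ω : Set ℝ) : Matrix (Fin N) (Fin N) ℂ :=
  Matrix.of fun i j => W i j Ω

/-- A matrix polynomial with complex coefficients. -/
abbrev MatrixPoly (N : ℕ) : Type := Matrix (Fin N) (Fin N) ℂ[X]

/-- The matrix `∫ P(t) dW(t) Q(t)*`; its `(i, j)` entry is
`∑ k l, ∫ P_{ik}(t) * conj (Q_{jl}(t)) dW_{kl}(t)`. -/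
def innerForm {N : ℕ} (W : MatrixMeasure N) (P Q : MatrixPoly N) : Matrix (Fin N) (Fin N) ℂ :=
  Matrix.of fun i j => ∑ k, ∑ l,
    (W k l).integral
      (fun t : ℝ => (P i k).eval (t : ℂ) * (starRingEnd ℂ) ((Q j l).eval (t : ℂ)))
      (ContinuousLinearMap.mul ℝ ℂ)

/-- A weight matrix: `W(Ω)` is positive semidefinite for every Borel set `Ω`, all moments are
finite, and `∫ P dW P*` is nonsingular whenever the leading coefficient of the matrix polynomial
`P` is nonsingular. -/
structure IsWeightMatrix {N : ℕ} (W : MatrixMeasure N) : Prop where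
  posSemidef : ∀ Ω : Set ℝ, MeasurableSet Ω → (massOf W Ω).PosSemidef
  moments : ∀ (n : ℕ) (i j : Fin N), (W i j).Integrable (fun t : ℝ => (t : ℂ) ^ n)
  nonsingular : ∀ (n : ℕ) (P : MatrixPoly N), (∀ i j, (P i j).natDegree ≤ n) →
    (P.map fun p => p.coeff n).det ≠ 0 → (innerForm W P P).det ≠ 0

/-- A right-hand side differential operator `∂² F₂(t) + ∂¹ F₁(t) + ∂⁰ F₀` whose coefficients
are matrix polynomials with `deg F₂ ≤ 2`, `deg F₁ ≤ 1` and `F₀` constant. -/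
structure DiffOp (N : ℕ) where
  F₂ : MatrixPoly N
  F₁ : MatrixPoly N
  F₀ : Matrix (Fin N) (Fin N) ℂ
  deg₂ : ∀ i j, (F₂ i j).natDegree ≤ 2
  deg₁ : ∀ i j, (F₁ i j).natDegree ≤ 1

/-- The action `P D = P'' F₂ + P' F₁ + P F₀`. -/
def DiffOp.apply {N : ℕ} (D : DiffOp N) (P : MatrixPoly N) : MatrixPoly N :=
  P.map (fun p => derivative (derivative p)) * D.F₂ + P.map (fun p => derivative p) * D.F₁
    + P * D.F₀.map C

/-- All coefficients of `D` are real. -/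
def DiffOp.IsReal {N : ℕ} (D : DiffOp N) : Prop :=
  ∀ i j, (∀ n, ((D.F₂ i j).coeff n).im = 0) ∧ (∀ n, ((D.F₁ i j).coeff n).im = 0) ∧
    (D.F₀ i j).im = 0

/-- `D` is symmetric with respect to `W`: `⟨P D, Q⟩ = ⟨P, Q D⟩` for all matrix polynomials. -/
def DiffOp.IsSymmetric {N : ℕ} (D : DiffOp N) (W : MatrixMeasure N) : Prop :=
  ∀ P Q : MatrixPoly N, innerForm W (D.apply P) Q = innerForm W P (D.apply Q)

/-- The set `Υ(D)` of all weight matrices with respect to which `D` is symmetric. -/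
def Upsilon {N : ℕ} (D : DiffOp N) : Set (MatrixMeasure N) :=
  {W | IsWeightMatrix W ∧ D.IsSymmetric W}

/-- The constraints `F₂(t₀) M = 0`, `F₁(t₀) M = 0` and `F₀ M = M F₀*`. -/
def MassConstraints {N : ℕ} (D : DiffOp N) (t₀ : ℝ) (M : Matrix (Fin N) (Fin N) ℂ) : Prop :=
  D.F₂.map (fun p => p.eval (t₀ : ℂ)) * M = 0 ∧
  D.F₁.map (fun p => p.eval (t₀ : ℂ)) * M = 0 ∧
  D.F₀ * M = M * D.F₀.conjTranspose

/-- The matrix measure `δ_{t₀} M`. -/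
def pointMass {N : ℕ} (t₀ : ℝ) (M : Matrix (Fin N) (Fin N) ℂ) : MatrixMeasure N :=
  Matrix.of fun i j => VectorMeasure.dirac t₀ (M i j)

/-- The density of `W_{α,β,k}` at `t ∈ (0, 1)`. -/
def jacobiDensity (α β k t : ℝ) : Matrix (Fin 2) (Fin 2) ℝ :=
  (t ^ α * (1 - t) ^ β) •
    !![k * t ^ 2 + β - k + 1, (β - k + 1) * (1 - t);
       (β - k + 1) * (1 - t), (β - k + 1) * (1 - t) ^ 2]

/-- The matrix measure `W_{α,β,k}(t) χ_{(0,1)}(t) dt`. -/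
def jacobiWeight (α β k : ℝ) : MatrixMeasure 2 :=
  Matrix.of fun i j =>
    (volume.restrict (Set.Ioo (0 : ℝ) 1)).withDensityᵥ
      (fun t : ℝ => ((jacobiDensity α β k t i j : ℝ) : ℂ))

/-- `φ^±(t₀) = (2 - t₀ ± √(2 t₀² - 2 t₀ + 1)) / (t₀ + 3)`, the sign being `ε = ±1`. -/
def phi (ε t₀ : ℝ) : ℝ := (2 - t₀ + ε * √(2 * t₀ ^ 2 - 2 * t₀ + 1)) / (t₀ + 3)

/-- The quotient `(1 - t₀) / φ^±(t₀)`, with its limiting value `2` where `φ^±(t₀) = 0`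
(for `t₀ ≠ -3` this happens only for `φ^-` at `t₀ = 1`). -/
def quot (ε t₀ : ℝ) : ℝ := if phi ε t₀ = 0 then 2 else (1 - t₀) / phi ε t₀

/-- The coefficient `F₂` of the explicit operator for `α = β = 0`, `k = 1/2`. -/
def explicitF₂ (ε t₀ : ℝ) : MatrixPoly 2 :=
  let s : ℂ[X] := C (t₀ : ℂ)
  let q : ℂ[X] := C (quot ε t₀ : ℂ)
  !![(1 - X) * (-s + X * (2 * s - 3)) + q * (X * (1 - X)), 2 * X + s - 2 * s * X - s * X ^ 2;
     -s * (1 - X) ^ 2, (X - 1) * (X - s) + q * (X * (1 - X))]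

/-- The coefficient `F₁` of the explicit operator for `α = β = 0`, `k = 1/2`. -/
def explicitF₁ (ε t₀ : ℝ) : MatrixPoly 2 :=
  let s : ℂ[X] := C (t₀ : ℂ)
  let q : ℂ[X] := C (quot ε t₀ : ℂ)
  !![12 * X - 10 + 8 * s * (1 - X) - q * (4 * X - 3), 9 - X - 4 * s * (X + 2) - 2 * q;
     (1 - 4 * s) * (X - 1), 4 * (X - s) - q * (4 * X - 1)]

/-- The coefficient `F₀` of the explicit operator for `α = β = 0`, `k = 1/2`. -/
def explicitF₀ (ε t₀ : ℝ) : Matrix (Fin 2) (Fin 2) ℂ :=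
  let q : ℝ := quot ε t₀
  (!![q * (1 + 2 * phi ε t₀) / 2, -t₀ - 3 + q / 2;
      -t₀ + q / 2, -(q * (1 + 2 * phi ε t₀) / 2)] : Matrix (Fin 2) (Fin 2) ℝ).map
    (fun x : ℝ => (x : ℂ))

/-- The explicit operator for `α = β = 0`, `k = 1/2`. -/
def explicitOp (ε t₀ : ℝ) : DiffOp 2 where
  F₂ := explicitF₂ ε t₀
  F₁ := explicitF₁ ε t₀
  F₀ := explicitF₀ ε t₀
  deg₂ := by
    intro i j
    fin_cases i <;> fin_cases j <;> simp [explicitF₂] <;> compute_degree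
  deg₁ := by
    intro i j
    fin_cases i <;> fin_cases j <;> simp [explicitF₁] <;> compute_degree

/-- The explicit mass `[[1, φ], [φ, φ²]]` for `α = β = 0`, `k = 1/2`. -/
def explicitM (ε t₀ : ℝ) : Matrix (Fin 2) (Fin 2) ℂ :=
  (!![1, phi ε t₀; phi ε t₀, phi ε t₀ ^ 2] : Matrix (Fin 2) (Fin 2) ℝ).map
    (fun x : ℝ => (x : ℂ))

end MatrixWeight

end

noncomputable section

namespace MatrixWeight

section

/-! ### Integrals against complex measures -/

/-! The operators come from a three-parameter family that is symmetric for the Jacobi weight by a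
Lagrange identity: the defect of symmetry is a Pearson derivative of a boundary form, and it
integrates to zero (`jacobiOp_lagrange`, `jacobiInt_pearson`). The mass is taken as `v vᵀ` with `v =
(1, φ)`. For suitable parameters the mass constraints reduce to two scalar relations
(`MassRelations`), hence to a quadratic equation for `φ`. Its leading coefficient vanishes only at
the excluded `t₀`, and its discriminant is a positive combination of squares.

The substance is that `Υ(D)` contains nothing else. For `U` in it, the total mass `m` satisfies `F₀
m = m F₀*`. Since `F₀` is real, traceless and not diagonal, this makes `m` real symmetric and
subject to one linear relation, which the total mass of `W` and the matrix `M` also satisfy;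
positivity then gives `m = γ W(ℝ) + ζ M` (`exists_eq_combination`). The difference `U - γ W - ζ δ M`
has zero total mass, and symmetry of `D` turns each further moment into a solution of a homogeneous
Sylvester equation. Its coefficient has determinant `k c a²` and nonzero trace, so every moment
vanishes (`DiffOp.IsSymmetric.polyIntegral_eq_zero`). The comparison measure has compact support, so
moments determine the measure (`IsWeightMatrix.eq_of_polyIntegral_eq`). Finally `ζ ≥ 0` is read off
the atom at `t₀`. -/

/-- The pairing is only given as real bilinear, so complex homogeneity needs its own proof. -/
theorem integral_complex_smul {V : ComplexMeasure ℝ} (c : ℂ) (f : ℝ → ℂ) :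
    V.integral (fun t => c * f t) (ContinuousLinearMap.mul ℝ ℂ) =
      c * V.integral f (ContinuousLinearMap.mul ℝ ℂ) := by
  rw [VectorMeasure.integral_eq_setToFun, VectorMeasure.integral_eq_setToFun]
  refine setToFun_smul (𝕜 := ℂ) _ (fun c s x => ?_) c f
  change (ContinuousLinearMap.mul ℝ ℂ) (c • x) (V s) = c • (ContinuousLinearMap.mul ℝ ℂ) x (V s)
  simp [mul_assoc]

theorem integral_indicator_const {V : ComplexMeasure ℝ} [IsFiniteMeasure V.variation]
    {s : Set ℝ} (hs : MeasurableSet s) (c : ℂ) :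
    V.integral (s.indicator fun _ => c) (ContinuousLinearMap.mul ℝ ℂ) = c * V s :=
  setToFun_indicator_const _ hs (measure_ne_top _ _) c

theorem norm_integral_le {V : ComplexMeasure ℝ} (f : ℝ → ℂ) :
    ‖V.integral f (ContinuousLinearMap.mul ℝ ℂ)‖ ≤ ∫ t, ‖f t‖ ∂V.variation := by
  simpa using VectorMeasure.norm_integral_le_integral_norm (μ := V) (f := f)
    (B := ContinuousLinearMap.mul ℝ ℂ)

theorem integrable_withDensityᵥ {μ : Measure ℝ} {f g : ℝ → ℂ} (hg : Integrable g μ)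
    (hfg : Integrable (fun t => f t * g t) μ) (hf : Measurable f) :
    (μ.withDensityᵥ g).Integrable f := by
  rw [VectorMeasure.Integrable, Measure.variation_withDensityᵥ hg,
    integrable_withDensity_iff_integrable_smul₀' hg.aestronglyMeasurable.enorm
      (Filter.Eventually.of_forall fun _ => by simp)]
  refine hfg.norm.mono' ?_ ?_
  · exact (hg.aestronglyMeasurable.enorm.ennreal_toReal.aestronglyMeasurable).smul
      hf.aestronglyMeasurable
  · filter_upwards with t
    simp [mul_comm]

/-- The variation of `g dμ` is `|g| dμ`. Both sides agree on indicators and are additive and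
continuous for the `L¹` norm of the variation, so induction on integrable functions applies. -/
theorem integral_withDensityᵥ {μ : Measure ℝ} {f g : ℝ → ℂ} (hg : Integrable g μ)
    (hf : (μ.withDensityᵥ g).Integrable f) :
    (μ.withDensityᵥ g).integral f (ContinuousLinearMap.mul ℝ ℂ) = ∫ t, f t * g t ∂μ := by
  have hvar := Measure.variation_withDensityᵥ hg
  have hfin : IsFiniteMeasure (μ.withDensityᵥ g).variation := by
    rw [hvar]
    exact ⟨by simpa using! hg.2⟩
  have key (f : ℝ → ℂ) (hf : (μ.withDensityᵥ g).Integrable f) :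
      Integrable (fun t => f t * g t) μ ∧
      ∫ t, ‖f t * g t‖ ∂μ = ∫ t, ‖f t‖ ∂(μ.withDensityᵥ g).variation := by
    rw [VectorMeasure.Integrable, hvar,
      integrable_withDensity_iff_integrable_smul₀' hg.aestronglyMeasurable.enorm
      (Filter.Eventually.of_forall fun _ => by simp)] at hf
    constructor
    -- Multiplying `|g| f` by the bounded phase of `g` recovers `f g`.
    · have h1 : Integrable (fun t => (g t / ‖g t‖) * (‖g t‖ₑ.toReal • f t)) μ := by
        refine hf.bdd_mul (c := 1) ?_ ?_
        · exact ((hg.aestronglyMeasurable.aemeasurable.div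
            (Complex.measurable_ofReal.comp_aemeasurable
              hg.aestronglyMeasurable.norm.aemeasurable))).aestronglyMeasurable
        · filter_upwards with t
          by_cases h : g t = 0 <;> simp [h]
      refine h1.congr ?_
      filter_upwards with t
      by_cases h : g t = 0
      · simp [h]
      · have : (‖g t‖ : ℂ) ≠ 0 := by simpa using h
        simp only [toReal_enorm, Complex.real_smul]
        field_simp
    · rw [hvar, integral_withDensity_eq_integral_toReal_smul₀ hg.aestronglyMeasurable.enorm
        (Filter.Eventually.of_forall fun _ => by simp)]
      simp [mul_comm]
  refine Integrable.induction (P := fun f => (μ.withDensityᵥ g).integral f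
    (ContinuousLinearMap.mul ℝ ℂ) = ∫ t, f t * g t ∂μ) ?_ ?_ ?_ ?_ hf
  · intro c s hs _
    rw [integral_indicator_const hs, withDensityᵥ_apply hg hs, ← integral_const_mul,
      ← integral_indicator hs]
    congr 1
    ext t
    by_cases ht : t ∈ s <;> simp [ht]
  · intro f₁ f₂ _ h₁ h₂ e₁ e₂
    rw [show f₁ + f₂ = fun x => f₁ x + f₂ x from rfl,
      VectorMeasure.integral_fun_add h₁ h₂, e₁, e₂, ← integral_add (key _ h₁).1 (key _ h₂).1]
    simp [add_mul]
  · refine isClosed_eq VectorMeasure.continuous_integral ?_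
    refine LipschitzWith.continuous (K := 1) (LipschitzWith.of_dist_le_mul fun u v => ?_)
    have hu := L1.integrable_coeFn u
    have hv := L1.integrable_coeFn v
    rw [dist_eq_norm, ← integral_sub (key _ hu).1 (key _ hv).1, L1.dist_eq_integral_dist]
    simp only [NNReal.coe_one, one_mul, dist_eq_norm]
    have h2 := (key _ (hu.sub hv)).2
    simp only [Pi.sub_apply] at h2
    rw [← h2]
    refine (norm_integral_le_integral_norm _).trans (le_of_eq ?_)
    simp [sub_mul]
  · intro f₁ f₂ h _ e
    rw [← VectorMeasure.integral_congr_ae h, e]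
    refine integral_congr_ae ?_
    rw [Filter.EventuallyEq, hvar, ae_withDensity_iff' hg.aestronglyMeasurable.enorm] at h
    filter_upwards [h] with t ht
    by_cases h0 : g t = 0
    · simp [h0]
    · rw [ht (by simpa using h0)]

/-! ### Polynomial moments -/

/-- All moments of the complex measure `V` are finite. -/
def HasMoments (V : ComplexMeasure ℝ) : Prop :=
  ∀ n : ℕ, V.Integrable (fun t : ℝ => (t : ℂ) ^ n)

/-- The integral of a polynomial against a complex measure. -/
def polyIntegral (V : ComplexMeasure ℝ) (p : ℂ[X]) : ℂ :=
  V.integral (fun t : ℝ => p.eval (t : ℂ)) (ContinuousLinearMap.mul ℝ ℂ)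

variable {V V₁ V₂ : ComplexMeasure ℝ}

theorem HasMoments.integrable_eval (h : HasMoments V) (p : ℂ[X]) :
    V.Integrable (fun t : ℝ => p.eval (t : ℂ)) := by
  simp only [Polynomial.eval_eq_sum_range]
  exact integrable_finsetSum _ fun n _ => (h n).const_mul _

theorem HasMoments.isFiniteMeasure (h : HasMoments V) : IsFiniteMeasure V.variation := by
  have := h 0
  simp only [pow_zero] at this
  rcases (integrable_const_iff.1 this) with h | h
  · simp at h
  · exact h

theorem HasMoments.add (h₁ : HasMoments V₁) (h₂ : HasMoments V₂) : HasMoments (V₁ + V₂) :=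
  fun n => (h₁ n).add_vectorMeasure (h₂ n)

theorem HasMoments.sub (h₁ : HasMoments V₁) (h₂ : HasMoments V₂) : HasMoments (V₁ - V₂) :=
  fun n => (h₁ n).sub_vectorMeasure (h₂ n)

theorem HasMoments.smul (h : HasMoments V) (c : ℝ) : HasMoments (c • V) :=
  fun n => (h n).smul_vectorMeasure c

theorem HasMoments.dirac (t₀ : ℝ) (m : ℂ) : HasMoments (VectorMeasure.dirac t₀ m) := by
  intro n
  rw [VectorMeasure.Integrable, VectorMeasure.variation_dirac]
  refine Integrable.smul_measure ?_ (by simp)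
  exact integrable_dirac (by simp)

theorem polyIntegral_add (h : HasMoments V) (p q : ℂ[X]) :
    polyIntegral V (p + q) = polyIntegral V p + polyIntegral V q := by
  simp only [polyIntegral, eval_add]
  exact VectorMeasure.integral_fun_add (h.integrable_eval p) (h.integrable_eval q)

theorem polyIntegral_C_mul (c : ℂ) (p : ℂ[X]) :
    polyIntegral V (C c * p) = c * polyIntegral V p := by
  simp only [polyIntegral, eval_mul, eval_C]
  exact integral_complex_smul c _

theorem polyIntegral_add_measure (h₁ : HasMoments V₁) (h₂ : HasMoments V₂) (p : ℂ[X]) :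
    polyIntegral (V₁ + V₂) p = polyIntegral V₁ p + polyIntegral V₂ p :=
  VectorMeasure.integral_add_vectorMeasure (h₁.integrable_eval p) (h₂.integrable_eval p)

theorem polyIntegral_sub_measure (h₁ : HasMoments V₁) (h₂ : HasMoments V₂) (p : ℂ[X]) :
    polyIntegral (V₁ - V₂) p = polyIntegral V₁ p - polyIntegral V₂ p :=
  VectorMeasure.integral_sub_vectorMeasure (h₁.integrable_eval p) (h₂.integrable_eval p)

theorem polyIntegral_smul_measure (c : ℝ) (p : ℂ[X]) :
    polyIntegral (c • V) p = c * polyIntegral V p := by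
  simp [polyIntegral, VectorMeasure.integral_smul_vectorMeasure]

theorem polyIntegral_dirac (t₀ : ℝ) (m : ℂ) (p : ℂ[X]) :
    polyIntegral (VectorMeasure.dirac t₀ m) p = p.eval (t₀ : ℂ) * m := by
  simp [polyIntegral, VectorMeasure.integral_dirac]

/-- Integration of polynomials as a linear functional. -/
def HasMoments.functional (h : HasMoments V) : ℂ[X] →ₗ[ℂ] ℂ where
  toFun := polyIntegral V
  map_add' := polyIntegral_add h
  map_smul' c p := by rw [smul_eq_C_mul, polyIntegral_C_mul]; rfl

theorem HasMoments.functional_apply (h : HasMoments V) (p : ℂ[X]) :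
    h.functional p = polyIntegral V p := rfl

theorem polyIntegral_eq_zero_of_pow (h : HasMoments V) (h0 : ∀ n : ℕ, polyIntegral V (X ^ n) = 0)
    (p : ℂ[X]) : polyIntegral V p = 0 := by
  have : h.functional = 0 := by
    refine Polynomial.lhom_ext' fun n => LinearMap.ext_ring ?_
    simpa [monomial_one_right_eq_X_pow, h.functional_apply] using h0 n
  rw [← h.functional_apply, this]; rfl

end

section

/-! ### Determinacy of compactly supported matrix measures -/

/-- Markov's inequality for `t ^ (2 n)` bounds the mass by `K (R / (R + 1)) ^ (2 n)`, which tends to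
zero. -/
theorem measure_abs_ge_eq_zero {ν : Measure ℝ} [IsFiniteMeasure ν] {K R : ℝ} (hR : 0 ≤ R)
    (hint : ∀ n : ℕ, Integrable (fun t : ℝ => t ^ (2 * n)) ν)
    (h : ∀ n : ℕ, ∫ t, t ^ (2 * n) ∂ν ≤ K * R ^ (2 * n)) :
    ν {t | R + 1 ≤ |t|} = 0 := by
  have hbound (n : ℕ) : ν.real {t | R + 1 ≤ |t|} ≤ K * ((R / (R + 1)) ^ 2) ^ n := by
    have h1 := mul_meas_ge_le_integral_of_nonneg (μ := ν)
      (f := fun t : ℝ => t ^ (2 * n))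
      (Filter.Eventually.of_forall fun t => by
        simp only [Pi.zero_apply, pow_mul]; positivity) (hint n) ((R + 1) ^ (2 * n))
    have h2 : ν.real {t | R + 1 ≤ |t|} ≤ ν.real {t | (R + 1) ^ (2 * n) ≤ t ^ (2 * n)} := by
      refine measureReal_mono fun t (ht : R + 1 ≤ |t|) => ?_
      have : |t| ^ (2 * n) = t ^ (2 * n) := by rw [pow_mul, sq_abs, ← pow_mul]
      simp only [Set.mem_ofPred_eq]
      rw [← this]
      gcongr
    have h3 : 0 < (R + 1) ^ (2 * n) := by positivity
    have h4 : (R + 1) ^ (2 * n) * ν.real {t | R + 1 ≤ |t|} ≤ K * R ^ (2 * n) :=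
      (mul_le_mul_of_nonneg_left h2 h3.le).trans (h1.trans (h n))
    rw [← pow_mul, div_pow, mul_div_assoc', le_div_iff₀ h3, mul_comm]
    exact h4
  have hlt : (R / (R + 1)) ^ 2 < 1 := by
    rw [sq_lt_one_iff₀ (by positivity), div_lt_one (by positivity)]
    linarith
  have hlim := (tendsto_pow_atTop_nhds_zero_of_lt_one (by positivity) hlt).const_mul K
  rw [mul_zero] at hlim
  have h0 : ν.real {t | R + 1 ≤ |t|} ≤ 0 := ge_of_tendsto' hlim hbound
  exact (measureReal_eq_zero_iff).1 (le_antisymm h0 measureReal_nonneg)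

/-- An indicator is approximated in `L¹` of the variation by a bounded continuous function, and the
latter uniformly on `[-R, R]` by a polynomial (Weierstrass). -/
theorem eq_zero_of_polyIntegral_eq_zero {V : ComplexMeasure ℝ} (hV : HasMoments V) {R : ℝ}
    (hsupp : V.variation {t | R ≤ |t|} = 0) (h : ∀ p, polyIntegral V p = 0) :
    V = 0 := by
  have := hV.isFiniteMeasure
  have hae : ∀ᵐ t ∂V.variation, |t| ≤ R := by
    rw [ae_iff]
    refine measure_mono_null (fun t ht => ?_) hsupp
    simp only [Set.mem_ofPred_eq, not_le] at ht ⊢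
    exact ht.le
  ext1 s hs
  rw [FunLike.coe_zero, Pi.zero_apply, ← norm_le_zero_iff]
  refine le_of_forall_pos_le_add fun ε hε => ?_
  rw [zero_add]
  set m := V.variation.real Set.univ with hm
  have hm0 : 0 ≤ m := measureReal_nonneg
  have hind : V.Integrable (s.indicator fun _ => (1 : ℂ)) :=
    (integrable_const (1 : ℂ)).indicator hs
  obtain ⟨g, hg, hgint⟩ := hind.exists_boundedContinuous_integral_sub_le (half_pos hε)
  let gK : C(Set.Icc (-R) R, ℂ) := ⟨fun t => g t, by fun_prop⟩
  have hδ : 0 < ε / (2 * (m + 1)) := by positivity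
  -- uniform polynomial approximation of the real and imaginary parts
  have happ (f : ℝ → ℝ) (hf : Continuous f) : ∃ p : ℝ[X], ∀ t ∈ Set.Icc (-R) R,
      |p.eval t - f t| < ε / (4 * (m + 1)) :=
    exists_polynomial_near_of_continuousOn _ _ f hf.continuousOn _ (by positivity)
  obtain ⟨p₁, hp₁⟩ := happ (fun t => (g t).re) (by fun_prop)
  obtain ⟨p₂, hp₂⟩ := happ (fun t => (g t).im) (by fun_prop)
  let p : ℂ[X] := p₁.map (algebraMap ℝ ℂ) + C Complex.I * p₂.map (algebraMap ℝ ℂ)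
  have hp (t : ℝ) (ht : |t| ≤ R) : ‖g t - p.eval (t : ℂ)‖ ≤ ε / (2 * (m + 1)) := by
    have h1 := hp₁ t (abs_le.1 ht)
    have h2 := hp₂ t (abs_le.1 ht)
    have he (q : ℝ[X]) : (q.map (algebraMap ℝ ℂ)).eval (t : ℂ) = ((q.eval t : ℝ) : ℂ) := by
      rw [eval_map]
      exact eval₂_at_apply (algebraMap ℝ ℂ) t
    have : g t - p.eval (t : ℂ) = (((g t).re - p₁.eval t : ℝ) : ℂ)
        + (((g t).im - p₂.eval t : ℝ) : ℂ) * Complex.I := by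
      simp only [p, eval_add, eval_mul, eval_C, he]
      apply Complex.ext <;> simp
    rw [this]
    refine (norm_add_le _ _).trans ?_
    rw [norm_mul, Complex.norm_I, mul_one, Complex.norm_real, Complex.norm_real,
      Real.norm_eq_abs, Real.norm_eq_abs, abs_sub_comm, abs_sub_comm (g t).im]
    have : ε / (2 * (m + 1)) = ε / (4 * (m + 1)) + ε / (4 * (m + 1)) := by field_simp; norm_num
    linarith
  have hpint := hV.integrable_eval p
  -- Since the integral of `p` vanishes, subtracting it is free; the two errors are then bounded
  -- separately.
  have e1 : V s = V.integral (fun t => (s.indicator (fun _ => (1 : ℂ)) t - g t)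
      + (g t - p.eval (t : ℂ))) (ContinuousLinearMap.mul ℝ ℂ) := by
    have h1 := integral_indicator_const (V := V) hs 1
    rw [one_mul] at h1
    have h2 := h p
    rw [polyIntegral] at h2
    rw [← h1, ← sub_zero (V.integral (s.indicator _) _), ← h2,
      ← VectorMeasure.integral_fun_sub hind hpint]
    simp
  rw [e1]
  refine (norm_integral_le _).trans ?_
  have hi1 := (hind.sub hgint).norm
  have hi2 := (hgint.sub hpint).norm
  calc ∫ t, ‖(s.indicator (fun _ => (1 : ℂ)) t - g t) + (g t - p.eval (t : ℂ))‖ ∂V.variation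
      ≤ ∫ t, (‖s.indicator (fun _ => (1 : ℂ)) t - g t‖ + ‖g t - p.eval (t : ℂ)‖) ∂V.variation := by
        refine integral_mono ((hind.sub hgint).add (hgint.sub hpint)).norm (hi1.add hi2) fun t => ?_
        exact norm_add_le _ _
    _ = (∫ t, ‖s.indicator (fun _ => (1 : ℂ)) t - g t‖ ∂V.variation)
        + ∫ t, ‖g t - p.eval (t : ℂ)‖ ∂V.variation := integral_add hi1 hi2
    _ ≤ ε / 2 + ∫ _, ε / (2 * (m + 1)) ∂V.variation := by
        refine add_le_add hg (integral_mono_ae hi2 (integrable_const _) ?_)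
        filter_upwards [hae] with t ht using hp t ht
    _ ≤ ε / 2 + ε / 2 := by
        gcongr
        rw [integral_const, ← hm, smul_eq_mul, mul_div_assoc', div_le_div_iff₀ (by positivity)
          (by positivity)]
        nlinarith
    _ = ε := by ring

/-- The form with density `1` lets `integral_withDensityᵥ` turn vector integrals into ordinary ones.
-/
theorem exists_measure_of_nonneg {V : ComplexMeasure ℝ}
    (h : ∀ s, MeasurableSet s → 0 ≤ V s) :
    ∃ ν : Measure ℝ, IsFiniteMeasure ν ∧ V = ν.withDensityᵥ (fun _ => (1 : ℂ)) ∧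
      ∀ s, MeasurableSet s → V s = (ν.real s : ℂ) := by
  have h0 : 0 ≤[Set.univ] ComplexMeasure.re V := by
    rw [VectorMeasure.le_restrict_univ_iff_le]
    intro s hs
    exact (Complex.le_def.1 (h s hs)).1
  have key : ∀ s, MeasurableSet s → V s =
      (((ComplexMeasure.re V).toMeasureOfZeroLE Set.univ MeasurableSet.univ h0).real s : ℂ) := by
    intro s hs
    rw [SignedMeasure.toMeasureOfZeroLE_real_apply _ _ _ hs, Set.univ_inter]
    apply Complex.ext
    · rfl
    · simpa using (Complex.le_def.1 (h s hs)).2.symm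
  refine ⟨_, inferInstance, ?_, key⟩
  ext1 s hs
  rw [key s hs, withDensityᵥ_apply (integrable_const _) hs]
  simp

/-- A nonnegative determinant gives `|A₀₁|² ≤ A₀₀ A₁₁`. This lets the diagonal measures control the
off-diagonal ones. -/
theorem norm_apply_le_of_posSemidef {A : Matrix (Fin 2) (Fin 2) ℂ} (hA : A.PosSemidef)
    (i j : Fin 2) : ‖A i j‖ ≤ (A 0 0).re + (A 1 1).re := by
  have h0 := Complex.le_def.1 (hA.diag_nonneg (i := 0))
  have h1 := Complex.le_def.1 (hA.diag_nonneg (i := 1))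
  simp only [Complex.zero_re, Complex.zero_im] at h0 h1
  have hd := (Complex.le_def.1 hA.det_nonneg).1
  have h01 : A 1 0 = star (A 0 1) := (hA.1.apply 1 0).symm
  have e0 : A 0 0 = ((A 0 0).re : ℂ) := Complex.ext rfl (by simp [← h0.2])
  have e1 : A 1 1 = ((A 1 1).re : ℂ) := Complex.ext rfl (by simp [← h1.2])
  have hoff : ‖A 0 1‖ ≤ (A 0 0).re + (A 1 1).re := by
    refine abs_le_of_sq_le_sq' ?_ (by linarith) |>.2
    rw [Matrix.det_fin_two, h01, e0, e1] at hd
    simp only [Complex.zero_re, Complex.sub_re, Complex.mul_re, Complex.ofReal_re,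
      Complex.ofReal_im, Complex.star_def, Complex.conj_re, Complex.conj_im] at hd
    rw [Complex.sq_norm, Complex.normSq_apply]
    nlinarith [h0.1, h1.1, mul_nonneg h0.1 h1.1]
  fin_cases i <;> fin_cases j <;> simp only [Fin.zero_eta, Fin.mk_one, Fin.isValue]
  · rw [e0, Complex.norm_real, Real.norm_of_nonneg h0.1]
    simpa using h1.1
  · exact hoff
  · rw [h01, norm_star]; exact hoff
  · rw [e1, Complex.norm_real, Real.norm_of_nonneg h1.1]
    simpa using h0.1

/-- Only `V` is assumed compactly supported. Its even moments bound those of the positive diagonal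
entries of `U`, which confines these to `|t| < R + 1`; positive semidefiniteness confines the
remaining entries. -/
theorem IsWeightMatrix.eq_of_polyIntegral_eq {U V : MatrixMeasure 2} (hU : IsWeightMatrix U)
    (hV : ∀ i j, HasMoments (V i j)) {R : ℝ} (hR : 0 ≤ R)
    (hsupp : ∀ i j, (V i j).variation {t | R ≤ |t|} = 0)
    (h : ∀ i j p, polyIntegral (U i j) p = polyIntegral (V i j) p) : U = V := by
  have hdiag (i : Fin 2) := exists_measure_of_nonneg (V := U i i) fun s hs =>
    (hU.posSemidef s hs).diag_nonneg (i := i)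
  choose ν hfin hdens hreal using hdiag
  have hmom (i j : Fin 2) : HasMoments (U i j) := fun n => hU.moments n i j
  have hνvar (i : Fin 2) : (U i i).variation = ν i := by
    rw [hdens i, Measure.variation_withDensityᵥ (integrable_const _)]
    simp
  have hνint (i : Fin 2) (n : ℕ) : Integrable (fun t : ℝ => t ^ (2 * n)) (ν i) := by
    have := (hmom i i (2 * n)).norm
    rw [hνvar] at this
    refine this.congr (Filter.Eventually.of_forall fun t => ?_)
    simp [pow_mul]
  have hν0 (i : Fin 2) : ν i {t | R + 1 ≤ |t|} = 0 := by
    refine measure_abs_ge_eq_zero (K := (V i i).variation.real Set.univ) hR (hνint i) fun n => ?_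
    have hVfin := (hV i i).isFiniteMeasure
    have hae : ∀ᵐ t ∂(V i i).variation, |t| ≤ R := by
      rw [ae_iff]
      refine measure_mono_null (fun t ht => ?_) (hsupp i i)
      simp only [Set.mem_ofPred_eq, not_le] at ht ⊢
      exact ht.le
    have e : ((∫ t, t ^ (2 * n) ∂ν i : ℝ) : ℂ) = polyIntegral (V i i) (X ^ (2 * n)) := by
      rw [← h, polyIntegral, hdens i, integral_withDensityᵥ (integrable_const _)
        (by rw [← hdens i]; exact (hmom i i).integrable_eval _), ← integral_complex_ofReal]
      simp
    have hle : ‖((∫ t, t ^ (2 * n) ∂ν i : ℝ) : ℂ)‖ ≤ (V i i).variation.real Set.univ * R ^ (2 * n) := by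
      rw [e, polyIntegral]
      refine (norm_integral_le _).trans ?_
      refine (integral_mono_ae ((hV i i).integrable_eval _).norm
        (integrable_const (R ^ (2 * n))) ?_).trans (by simp)
      filter_upwards [hae] with t ht
      simp only [eval_pow, eval_X, norm_pow, Complex.norm_real, Real.norm_eq_abs]
      gcongr
    rw [Complex.norm_real] at hle
    exact (le_abs_self _).trans hle
  have hUvar (i j : Fin 2) : (U i j).variation ≤ ν 0 + ν 1 := by
    refine VectorMeasure.variation_le_of_forall_enorm_le fun s hs => ?_
    have := norm_apply_le_of_posSemidef (hU.posSemidef s hs) i j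
    simp only [massOf, Matrix.of_apply, hreal _ s hs, Complex.ofReal_re] at this
    rw [← ofReal_norm, Measure.add_apply, ← ofReal_measureReal, ← ofReal_measureReal,
      ← ENNReal.ofReal_add measureReal_nonneg measureReal_nonneg]
    exact ENNReal.ofReal_le_ofReal this
  have hU0 (i j : Fin 2) : (U i j).variation {t | R + 1 ≤ |t|} = 0 := by
    refine le_antisymm ((hUvar i j _).trans ?_) (zero_le)
    simp [hν0]
  ext1 i j
  rw [← sub_eq_zero]
  refine eq_zero_of_polyIntegral_eq_zero ((hmom i j).sub (hV i j)) (R := R + 1) ?_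
    fun p => by rw [polyIntegral_sub_measure (hmom i j) (hV i j), h, sub_self]
  refine le_antisymm ((VectorMeasure.variation_sub_le _).trans ?_) (zero_le)
  rw [Measure.add_apply, hU0, zero_add]
  refine (measure_mono fun t (ht : R + 1 ≤ |t|) => ?_).trans (hsupp i j).le
  exact (by linarith : R ≤ |t|)

end

section

/-! ### Algebra of the inner form -/

theorem eval_map_conj (q : ℂ[X]) (t : ℝ) :
    (q.map (starRingEnd ℂ)).eval (t : ℂ) = (starRingEnd ℂ) (q.eval (t : ℂ)) := by
  rw [eval_map, ← eval₂_at_apply (starRingEnd ℂ), Complex.conj_ofReal]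

variable {N : ℕ} {W V : MatrixMeasure N}

theorem innerForm_apply (W : MatrixMeasure N) (P Q : MatrixPoly N) (i j : Fin N) :
    innerForm W P Q i j =
      ∑ k, ∑ l, polyIntegral (W k l) (P i k * (Q j l).map (starRingEnd ℂ)) := by
  simp only [innerForm, Matrix.of_apply, polyIntegral, eval_mul, eval_map_conj]

theorem innerForm_add_measure (hW : ∀ i j, HasMoments (W i j)) (hV : ∀ i j, HasMoments (V i j))
    (P Q : MatrixPoly N) : innerForm (W + V) P Q = innerForm W P Q + innerForm V P Q := by
  ext i j
  simp only [innerForm_apply, Matrix.add_apply, polyIntegral_add_measure (hW _ _) (hV _ _),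
    Finset.sum_add_distrib]

theorem innerForm_sub_measure (hW : ∀ i j, HasMoments (W i j)) (hV : ∀ i j, HasMoments (V i j))
    (P Q : MatrixPoly N) : innerForm (W - V) P Q = innerForm W P Q - innerForm V P Q := by
  ext i j
  simp only [innerForm_apply, Matrix.sub_apply, polyIntegral_sub_measure (hW _ _) (hV _ _),
    Finset.sum_sub_distrib]

theorem innerForm_smul_measure (c : ℝ) (P Q : MatrixPoly N) :
    innerForm (c • W) P Q = (c : ℂ) • innerForm W P Q := by
  ext i j
  simp only [innerForm_apply, Matrix.smul_apply, polyIntegral_smul_measure, smul_eq_mul,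
    Finset.mul_sum]

theorem innerForm_C_smul_left (c : ℂ) (P Q : MatrixPoly N) :
    innerForm W (C c • P) Q = c • innerForm W P Q := by
  ext i j
  simp only [innerForm_apply, Matrix.smul_apply, smul_eq_mul, mul_assoc, polyIntegral_C_mul,
    Finset.mul_sum]

theorem innerForm_C_smul_right (c : ℂ) (P Q : MatrixPoly N) :
    innerForm W P (C c • Q) = (starRingEnd ℂ c) • innerForm W P Q := by
  ext i j
  simp only [innerForm_apply, Matrix.smul_apply, smul_eq_mul, Polynomial.map_mul, map_C,
    mul_left_comm (P i _), polyIntegral_C_mul, Finset.mul_sum]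

theorem innerForm_one_right (P : MatrixPoly N) (i j : Fin N) :
    innerForm W P 1 i j = ∑ k, polyIntegral (W k j) (P i k) := by
  rw [innerForm_apply]
  refine Finset.sum_congr rfl fun k _ => ?_
  rw [Finset.sum_eq_single j]
  · simp
  · intro l _ hl
    simp [Matrix.one_apply_ne' hl, polyIntegral]
  · simp

theorem innerForm_one_left (Q : MatrixPoly N) (i j : Fin N) :
    innerForm W 1 Q i j = ∑ l, polyIntegral (W i l) ((Q j l).map (starRingEnd ℂ)) := by
  rw [innerForm_apply, Finset.sum_eq_single i]
  · simp
  · intro l _ hl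
    simp [Matrix.one_apply_ne' hl, polyIntegral]
  · simp

theorem DiffOp.IsSymmetric.add {D : DiffOp N} (hW : ∀ i j, HasMoments (W i j))
    (hV : ∀ i j, HasMoments (V i j)) (h₁ : D.IsSymmetric W) (h₂ : D.IsSymmetric V) :
    D.IsSymmetric (W + V) := fun P Q => by
  rw [innerForm_add_measure hW hV, innerForm_add_measure hW hV, h₁, h₂]

theorem DiffOp.IsSymmetric.sub {D : DiffOp N} (hW : ∀ i j, HasMoments (W i j))
    (hV : ∀ i j, HasMoments (V i j)) (h₁ : D.IsSymmetric W) (h₂ : D.IsSymmetric V) :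
    D.IsSymmetric (W - V) := fun P Q => by
  rw [innerForm_sub_measure hW hV, innerForm_sub_measure hW hV, h₁, h₂]

theorem DiffOp.IsSymmetric.smul {D : DiffOp N} (h : D.IsSymmetric W) (c : ℝ) :
    D.IsSymmetric (c • W) := fun P Q => by
  rw [innerForm_smul_measure, innerForm_smul_measure, h]

/-- The factor is real, so it leaves both slots of the sesquilinear form as the same scalar. -/
theorem isSymmetric_iff_of_apply_eq {D D' : DiffOp N} {r : ℝ} (hr : r ≠ 0)
    (h : ∀ P, D'.apply P = C (r : ℂ) • D.apply P) : D'.IsSymmetric W ↔ D.IsSymmetric W := by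
  have hr' : (r : ℂ) ≠ 0 := by exact_mod_cast hr
  simp only [DiffOp.IsSymmetric, h, innerForm_C_smul_left, innerForm_C_smul_right,
    Complex.conj_ofReal]
  exact forall₂_congr fun P Q => (smul_right_injective _ hr').eq_iff

/-! ### Point masses -/

theorem innerForm_pointMass (t₀ : ℝ) (M : Matrix (Fin N) (Fin N) ℂ) (P Q : MatrixPoly N) :
    innerForm (pointMass t₀ M) P Q =
      P.map (eval (t₀ : ℂ)) * M * (Q.map (eval (t₀ : ℂ))).conjTranspose := by
  ext i j
  simp only [innerForm_apply, pointMass, Matrix.of_apply, polyIntegral_dirac, Matrix.mul_apply,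
    Matrix.map_apply, Matrix.conjTranspose_apply, eval_mul, eval_map_conj, Finset.sum_mul]
  rw [Finset.sum_comm]
  refine Finset.sum_congr rfl fun k _ => Finset.sum_congr rfl fun l _ => ?_
  rw [starRingEnd_apply]
  ring

/-- At `t₀` the mass kills both derivative terms. What remains is `P(t₀) F₀ M Q(t₀)*`, and `F₀ M` is
Hermitian by the third constraint. -/
theorem MassConstraints.isSymmetric {D : DiffOp N} {t₀ : ℝ} {M : Matrix (Fin N) (Fin N) ℂ}
    (hM : M.IsHermitian) (h : MassConstraints D t₀ M) : D.IsSymmetric (pointMass t₀ M) := by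
  obtain ⟨h2, h1, h0⟩ := h
  have key (P : MatrixPoly N) :
      (D.apply P).map (eval (t₀ : ℂ)) * M = P.map (eval (t₀ : ℂ)) * (D.F₀ * M) := by
    have e (A B : MatrixPoly N) : (A * B).map (eval (t₀ : ℂ)) =
        A.map (eval (t₀ : ℂ)) * B.map (eval (t₀ : ℂ)) :=
      Matrix.map_mul (f := evalRingHom (t₀ : ℂ))
    have e0 : (D.F₀.map C).map (eval (t₀ : ℂ)) = D.F₀ := by ext i j; simp
    rw [DiffOp.apply, Matrix.map_add _ (fun _ _ => eval_add), Matrix.map_add _ (fun _ _ => eval_add),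
      e, e, e, e0, add_mul, add_mul, mul_assoc _ _ M, mul_assoc _ _ M, mul_assoc _ _ M]
    erw [h2, h1]
    simp
  intro P Q
  have hq : M * ((D.apply Q).map (eval (t₀ : ℂ))).conjTranspose =
      D.F₀ * M * (Q.map (eval (t₀ : ℂ))).conjTranspose := by
    have := congrArg Matrix.conjTranspose (key Q)
    rwa [Matrix.conjTranspose_mul, hM.eq, Matrix.conjTranspose_mul, Matrix.conjTranspose_mul,
      hM.eq, ← h0] at this
  rw [innerForm_pointMass, innerForm_pointMass, key, mul_assoc _ M, hq]
  simp only [mul_assoc]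

/-! ### Moments determined by the symmetry of a differential operator -/

/-- By Cayley–Hamilton, `G² ν = ν H²` reduces to `tr G • G ν = tr G • ν H`. So `G ν` equals both `ν
H` and `-ν H`, and invertibility of `G` finishes. -/
theorem eq_zero_of_sylvester {G H ν : Matrix (Fin 2) (Fin 2) ℂ} (htr : H.trace = G.trace)
    (hdet : H.det = G.det) (ht : G.trace ≠ 0) (hd : G.det ≠ 0) (h : G * ν + ν * H = 0) :
    ν = 0 := by
  have cayley (A : Matrix (Fin 2) (Fin 2) ℂ) : A * A = A.trace • A - A.det • 1 := by
    ext i j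
    fin_cases i <;> fin_cases j <;>
      simp [Matrix.mul_apply, Matrix.trace_fin_two, Matrix.det_fin_two] <;> ring
  have h1 : G * ν = -(ν * H) := eq_neg_of_add_eq_zero_left h
  have h2 : G * G * ν = ν * (H * H) := by
    rw [mul_assoc, h1, mul_neg, ← mul_assoc, h1, neg_mul, neg_neg, mul_assoc]
  rw [cayley, cayley, htr, hdet] at h2
  simp only [sub_mul, mul_sub, smul_mul_assoc, mul_smul_comm, one_mul, mul_one,
    sub_left_inj] at h2
  have h3 : G * ν = ν * H := smul_right_injective _ ht h2
  have h4 : G * ν = 0 := by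
    rw [← h3, ← two_smul ℂ] at h
    exact (smul_eq_zero.1 h).resolve_left two_ne_zero
  have hu : IsUnit G.det := isUnit_iff_ne_zero.2 hd
  calc ν = G⁻¹ * (G * ν) := by rw [← mul_assoc, Matrix.nonsing_inv_mul _ hu, one_mul]
    _ = 0 := by rw [h4, mul_zero]

theorem map_eq_coeff_mul_of_natDegree_le (L : ℂ[X] →ₗ[ℂ] ℂ) {n : ℕ}
    (hL : ∀ m < n, L (X ^ m) = 0) {q : ℂ[X]} (hq : q.natDegree ≤ n) :
    L q = q.coeff n * L (X ^ n) := by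
  rw [q.as_sum_range_C_mul_X_pow' (Nat.lt_succ_of_le hq), map_sum, Finset.sum_range_succ,
    Finset.sum_eq_zero, zero_add]
  · rw [← smul_eq_C_mul, map_smul, smul_eq_mul]
    simp only [finsetSum_coeff, coeff_C_mul, coeff_X_pow, mul_ite, mul_one, mul_zero]
    simp
  · intro m hm
    rw [← smul_eq_C_mul, map_smul, hL m (Finset.mem_range.1 hm), smul_zero]

/-- The coefficient of `t ^ (n + 1)` in `(t ^ (n + 1) I) D` is
`(n + 1) (leadingPencil D n) + F₀`. -/
def DiffOp.leadingPencil (D : DiffOp N) (n : ℕ) : Matrix (Fin N) (Fin N) ℂ :=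
  Matrix.of fun i j => n * (D.F₂ i j).coeff 2 + (D.F₁ i j).coeff 1

theorem DiffOp.apply_scalar (D : DiffOp N) (p : ℂ[X]) (i j : Fin N) :
    D.apply (Matrix.scalar (Fin N) p) i j =
      derivative (derivative p) * D.F₂ i j + derivative p * D.F₁ i j + p * C (D.F₀ i j) := by
  have e (f : ℂ[X] → ℂ[X]) (hf : f 0 = 0) :
      (Matrix.scalar (Fin N) p).map f = Matrix.diagonal fun _ => f p := by
    rw [Matrix.scalar_apply, Matrix.diagonal_map hf]
  rw [DiffOp.apply, e _ (by simp), e _ (by simp)]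
  simp [Matrix.scalar_apply, Matrix.diagonal_mul]

theorem DiffOp.natDegree_apply_scalar_le (D : DiffOp N) (n : ℕ) (i j : Fin N) :
    (D.apply (Matrix.scalar (Fin N) (X ^ (n + 1))) i j).natDegree ≤ n + 1 := by
  rw [D.apply_scalar]
  refine natDegree_add_le_of_degree_le (natDegree_add_le_of_degree_le ?_ ?_) ?_
  · rcases n with _ | n
    · simp
    · have : (derivative (derivative (X ^ (n + 1 + 1) : ℂ[X]))).natDegree ≤ n :=
        (natDegree_derivative_le _).trans
          ((Nat.sub_le_sub_right (natDegree_derivative_le _) 1).trans (by simp))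
      exact (natDegree_mul_le_of_le this (D.deg₂ i j)).trans le_rfl
  · refine natDegree_mul_le_of_le ((natDegree_derivative_le _).trans ?_) (D.deg₁ i j)
    simp
  · exact (natDegree_mul_C_le _ _).trans (by simp)

theorem DiffOp.coeff_apply_scalar (D : DiffOp N) (n : ℕ) (i j : Fin N) :
    (D.apply (Matrix.scalar (Fin N) (X ^ (n + 1))) i j).coeff (n + 1) =
      (n + 1) * D.leadingPencil n i j + D.F₀ i j := by
  have h2 : (derivative (derivative (X ^ (n + 1) : ℂ[X])) * D.F₂ i j).coeff (n + 1) =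
      (n + 1) * (n * (D.F₂ i j).coeff 2) := by
    rcases n with _ | n
    · simp
    · have : derivative (derivative (X ^ (n + 1 + 1) : ℂ[X])) =
          C ((n + 1 + 1 : ℂ) * (n + 1)) * X ^ n := by
        simp [mul_assoc]
      rw [this, mul_assoc, coeff_C_mul, show n + 1 + 1 = 2 + n by ring, coeff_X_pow_mul]
      push_cast
      ring
  have h1 : (derivative (X ^ (n + 1) : ℂ[X]) * D.F₁ i j).coeff (n + 1) =
      (n + 1) * (D.F₁ i j).coeff 1 := by
    have : derivative (X ^ (n + 1) : ℂ[X]) = C (n + 1 : ℂ) * X ^ n := by simp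
    rw [this, mul_assoc, coeff_C_mul, add_comm n 1, coeff_X_pow_mul]
  rw [D.apply_scalar, coeff_add, coeff_add, h1, h2, leadingPencil, Matrix.of_apply,
    coeff_mul_C, coeff_X_pow, if_pos rfl]
  ring

theorem DiffOp.IsReal.conj_leadingPencil {D : DiffOp N} (hD : D.IsReal) (n : ℕ) (i j : Fin N) :
    (starRingEnd ℂ) (D.leadingPencil n i j) = D.leadingPencil n i j := by
  obtain ⟨h2, h1, -⟩ := hD i j
  simp [leadingPencil, Complex.conj_eq_iff_im.2 (h2 2), Complex.conj_eq_iff_im.2 (h1 1)]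

theorem DiffOp.apply_one (D : DiffOp N) : D.apply 1 = D.F₀.map C := by
  ext1 i j
  have := D.apply_scalar 1 i j
  rw [map_one] at this
  simp [this]

/-- Once the lower moments vanish, only top coefficients contribute. Testing symmetry on `(t ^ (n +
1) I, I)` and on `(I, t ^ (n + 1) I)` gives two equations for the next moment `ν`; in their sum `F₀`
cancels, leaving `G ν + ν Gᵀ = 0`. No positivity enters, so the result applies to differences of
weights. -/
theorem DiffOp.IsSymmetric.polyIntegral_eq_zero {D : DiffOp 2} (hD : D.IsReal)
    {V : MatrixMeasure 2} (hV : ∀ i j, HasMoments (V i j)) (hsym : D.IsSymmetric V)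
    (htr : ∀ n, (D.leadingPencil n).trace ≠ 0) (hdet : ∀ n, (D.leadingPencil n).det ≠ 0)
    (h0 : ∀ i j, polyIntegral (V i j) 1 = 0) (i j : Fin 2) (p : ℂ[X]) :
    polyIntegral (V i j) p = 0 := by
  suffices h : ∀ n : ℕ, ∀ i j, polyIntegral (V i j) (X ^ n) = 0 from
    polyIntegral_eq_zero_of_pow (hV i j) (fun n => h n i j) p
  intro n
  induction n using Nat.strong_induction_on with
  | _ n ih =>
  rcases n with _ | n
  · simpa using h0
  set S : MatrixPoly 2 := Matrix.scalar (Fin 2) (X ^ (n + 1)) with hS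
  set ν : Matrix (Fin 2) (Fin 2) ℂ :=
    Matrix.of fun i j => polyIntegral (V i j) (X ^ (n + 1)) with hν
  set G := D.leadingPencil n with hG
  have htop (i j : Fin 2) (q : ℂ[X]) (hq : q.natDegree ≤ n + 1) :
      polyIntegral (V i j) q = q.coeff (n + 1) * ν i j :=
    map_eq_coeff_mul_of_natDegree_le (hV i j).functional (fun m hm => ih m hm i j) hq
  have hSl (i j k l : Fin 2) : polyIntegral (V i j) (D.apply S k l) =
      ((n + 1) * G k l + D.F₀ k l) * ν i j := by
    rw [htop _ _ _ (D.natDegree_apply_scalar_le n _ _), D.coeff_apply_scalar]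
  have hSr (i j k l : Fin 2) :
      polyIntegral (V i j) ((D.apply S k l).map (starRingEnd ℂ)) =
      starRingEnd ℂ ((n + 1) * G k l + D.F₀ k l) * ν i j := by
    rw [htop _ _ _ (natDegree_map_le.trans (D.natDegree_apply_scalar_le n _ _)), coeff_map,
      D.coeff_apply_scalar]
  have e1 : ((n + 1 : ℂ) • G + D.F₀) * ν = ν * D.F₀.conjTranspose := by
    ext i j
    have := congrFun₂ (hsym S 1) i j
    rw [innerForm_one_right, D.apply_one, innerForm_apply] at this
    simp only [hSl] at this
    rw [Matrix.mul_apply, Matrix.mul_apply]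
    simp only [Matrix.add_apply, Matrix.smul_apply, smul_eq_mul]
    rw [this, Finset.sum_eq_single i]
    · refine Finset.sum_congr rfl fun l _ => ?_
      rw [Matrix.map_apply, map_C, mul_comm, polyIntegral_C_mul, mul_comm]
      simp [hS, hν]
    · intro k _ hk
      simp [hS, Matrix.scalar_apply, Matrix.diagonal_apply_ne' _ hk, polyIntegral]
    · simp
  have e2 : ν * ((n + 1 : ℂ) • G + D.F₀).conjTranspose = D.F₀ * ν := by
    ext i j
    have := congrFun₂ (hsym 1 S) i j
    rw [innerForm_one_left, D.apply_one, innerForm_apply] at this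
    simp only [hSr] at this
    rw [Matrix.mul_apply, Matrix.mul_apply]
    simp only [Matrix.conjTranspose_apply, Matrix.add_apply, Matrix.smul_apply, smul_eq_mul,
      mul_comm (ν _ _)]
    refine this.symm.trans (Finset.sum_congr rfl fun k _ => ?_)
    rw [Finset.sum_eq_single j]
    · rw [Matrix.map_apply, polyIntegral_C_mul]
      simp [hS, hν]
    · intro l _ hl
      simp [hS, Matrix.scalar_apply, Matrix.diagonal_apply_ne' _ hl, polyIntegral]
    · simp
  have hGc : G.conjTranspose = G.transpose := by
    ext i j
    exact hD.conj_leadingPencil n j i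
  have hn : (n + 1 : ℂ) ≠ 0 := by exact_mod_cast n.succ_ne_zero
  have hsyl : G * ν + ν * G.transpose = 0 := by
    have hc : star (n + 1 : ℂ) = n + 1 := by simp
    rw [Matrix.conjTranspose_add, Matrix.conjTranspose_smul, hGc, hc, mul_add] at e2
    rw [add_mul] at e1
    refine (smul_right_injective _ hn) ?_
    simp only [smul_zero, smul_add]
    rw [smul_mul_assoc] at e1
    rw [mul_smul_comm] at e2
    rw [eq_sub_of_add_eq e1, eq_sub_of_add_eq e2]
    abel
  have := eq_zero_of_sylvester (Matrix.trace_transpose G) (Matrix.det_transpose G) (htr n)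
    (hdet n) hsyl
  intro i j
  exact congrFun₂ this i j

end

section

/-! ### The scalar Jacobi functional -/

/-- The scalar Jacobi weight `t ^ α (1 - t) ^ β`. -/
def jacobiScalar (α β t : ℝ) : ℝ := t ^ α * (1 - t) ^ β

variable {α β : ℝ}

theorem jacobiScalar_pos {t : ℝ} (ht : t ∈ Set.Ioo (0 : ℝ) 1) : 0 < jacobiScalar α β t :=
  mul_pos (Real.rpow_pos_of_pos ht.1 _) (Real.rpow_pos_of_pos (by linarith [ht.2]) _)

theorem integrable_jacobiScalar (hα : -1 < α) (hβ : -1 < β) :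
    IntegrableOn (jacobiScalar α β) (Set.Ioo 0 1) := by
  have h := Complex.betaIntegral_convergent (u := ((α + 1 : ℝ) : ℂ)) (v := ((β + 1 : ℝ) : ℂ))
    (by simp; linarith) (by simp; linarith)
  rw [intervalIntegrable_iff_integrableOn_Ioo_of_le zero_le_one] at h
  refine IntegrableOn.congr_fun (f := fun t : ℝ => ((t : ℂ) ^ (((α + 1 : ℝ) : ℂ) - 1) *
    (1 - (t : ℂ)) ^ (((β + 1 : ℝ) : ℂ) - 1)).re) h.re (fun t ht => ?_) measurableSet_Ioo
  have h1 : 0 ≤ 1 - t := by linarith [ht.2]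
  have e : (t : ℂ) ^ (((α + 1 : ℝ) : ℂ) - 1) * (1 - (t : ℂ)) ^ (((β + 1 : ℝ) : ℂ) - 1) =
      ((jacobiScalar α β t : ℝ) : ℂ) := by
    rw [jacobiScalar, Complex.ofReal_mul, Complex.ofReal_cpow ht.1.le, Complex.ofReal_cpow h1]
    push_cast
    ring_nf
  simp only [e, Complex.ofReal_re]

theorem integrable_mul_jacobiScalar (hα : -1 < α) (hβ : -1 < β) {f : ℝ → ℂ} (hf : Continuous f) :
    IntegrableOn (fun t => f t * ((jacobiScalar α β t : ℝ) : ℂ)) (Set.Ioo 0 1) := by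
  obtain ⟨B, hB⟩ := (isCompact_Icc (a := (0 : ℝ)) (b := 1)).exists_bound_of_continuousOn
    hf.continuousOn
  refine (integrable_jacobiScalar hα hβ).ofReal.bdd_mul (c := B) hf.aestronglyMeasurable ?_
  filter_upwards [ae_restrict_mem measurableSet_Ioo] with t ht
  exact hB t (Set.Ioo_subset_Icc_self ht)

theorem continuous_eval_ofReal (q : ℂ[X]) : Continuous fun t : ℝ => q.eval (t : ℂ) :=
  q.continuous.comp Complex.continuous_ofReal

/-- The functional `q ↦ ∫₀¹ q(t) t ^ α (1 - t) ^ β dt`. -/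
def jacobiInt (hα : -1 < α) (hβ : -1 < β) : ℂ[X] →ₗ[ℂ] ℂ where
  toFun q := ∫ t in Set.Ioo (0 : ℝ) 1, q.eval (t : ℂ) * ((jacobiScalar α β t : ℝ) : ℂ)
  map_add' p q := by
    simp only [eval_add, add_mul]
    exact integral_add (integrable_mul_jacobiScalar hα hβ (continuous_eval_ofReal p))
      (integrable_mul_jacobiScalar hα hβ (continuous_eval_ofReal q))
  map_smul' c q := by
    simp only [eval_smul, smul_eq_mul, mul_assoc, RingHom.id_apply]
    exact integral_const_mul _ _

theorem jacobiInt_apply (hα : -1 < α) (hβ : -1 < β) (q : ℂ[X]) : jacobiInt hα hβ q =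
    ∫ t in Set.Ioo (0 : ℝ) 1, q.eval (t : ℂ) * ((jacobiScalar α β t : ℝ) : ℂ) := rfl

/-- The Pearson equation of the Jacobi weight. -/
theorem jacobiInt_pearson (hα : -1 < α) (hβ : -1 < β) (T : ℂ[X]) :
    jacobiInt hα hβ (X * (1 - X) * derivative T +
      (C ((α + 1 : ℝ) : ℂ) * (1 - X) - C ((β + 1 : ℝ) : ℂ) * X) * T) = 0 := by
  set T' : ℂ[X] := X * (1 - X) * derivative T +
      (C ((α + 1 : ℝ) : ℂ) * (1 - X) - C ((β + 1 : ℝ) : ℂ) * X) * T with hT'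
  -- An antiderivative of the integrand. Its exponents `α + 1` and `β + 1` are positive, so it is
  -- continuous up to the endpoints and vanishes there.
  let G : ℝ → ℂ := fun t => ((t ^ (α + 1) * (1 - t) ^ (β + 1) : ℝ) : ℂ) * T.eval (t : ℂ)
  have hcont : ContinuousOn G (Set.Icc 0 1) := by
    refine ContinuousOn.mul ?_ (continuous_eval_ofReal T).continuousOn
    refine (Complex.continuous_ofReal.comp ?_).continuousOn
    exact (Real.continuous_rpow_const (by linarith)).mul
      ((Real.continuous_rpow_const (by linarith)).comp (by fun_prop))
  have hderiv : ∀ t ∈ Set.Ioo (0 : ℝ) 1,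
      HasDerivAt G (T'.eval (t : ℂ) * ((jacobiScalar α β t : ℝ) : ℂ)) t := by
    intro t ht
    have ht0 : t ≠ 0 := ht.1.ne'
    have ht1 : 1 - t ≠ 0 := by linarith [ht.2]
    have h1 := Real.hasDerivAt_rpow_const (x := t) (p := α + 1) (Or.inl ht0)
    have h2 := ((hasDerivAt_id t).const_sub 1).rpow_const (p := β + 1) (Or.inl ht1)
    have h3 := ((T.hasDerivAt (t : ℂ)).comp_ofReal)
    convert! (h1.mul h2).ofReal_comp.mul h3 using 1
    simp only [add_sub_cancel_right, id, Pi.mul_apply]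
    rw [hT', jacobiScalar, Real.rpow_add_one ht0, Real.rpow_add_one ht1]
    simp only [eval_add, eval_mul, eval_sub, eval_one, eval_X, eval_C]
    push_cast
    ring
  have hint := integrable_mul_jacobiScalar hα hβ (continuous_eval_ofReal T')
  have := intervalIntegral.integral_eq_sub_of_hasDerivAt_of_le zero_le_one hcont hderiv
    ((intervalIntegrable_iff_integrableOn_Ioo_of_le zero_le_one).2 hint)
  rw [intervalIntegral.integral_of_le zero_le_one, integral_Ioc_eq_integral_Ioo] at this
  rw [jacobiInt_apply, this]
  have hα' : α + 1 ≠ 0 := by linarith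
  have hβ' : β + 1 ≠ 0 := by linarith
  simp [G, Real.zero_rpow hα', Real.zero_rpow hβ']

/-! ### The weight matrix of Jacobi type -/

/-- The polynomial part of the density of the weight matrix. -/
def jacobiPoly (β k : ℝ) : MatrixPoly 2 :=
  !![C (k : ℂ) * X ^ 2 + C ((β - k + 1 : ℝ) : ℂ), C ((β - k + 1 : ℝ) : ℂ) * (1 - X);
     C ((β - k + 1 : ℝ) : ℂ) * (1 - X), C ((β - k + 1 : ℝ) : ℂ) * (1 - X) ^ 2]

variable {k : ℝ}

theorem jacobiDensity_eq (t : ℝ) (i j : Fin 2) : ((jacobiDensity α β k t i j : ℝ) : ℂ) =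
    (jacobiPoly β k i j).eval (t : ℂ) * ((jacobiScalar α β t : ℝ) : ℂ) := by
  fin_cases i <;> fin_cases j <;> simp [jacobiDensity, jacobiPoly, jacobiScalar] <;> ring_nf

theorem jacobiWeight_integrable_density (hα : -1 < α) (hβ : -1 < β) (i j : Fin 2) :
    IntegrableOn (fun t : ℝ => ((jacobiDensity α β k t i j : ℝ) : ℂ)) (Set.Ioo 0 1) := by
  simp only [jacobiDensity_eq]
  exact integrable_mul_jacobiScalar hα hβ (continuous_eval_ofReal _)

theorem jacobiWeight_apply (α β k : ℝ) (i j : Fin 2) : jacobiWeight α β k i j =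
    (volume.restrict (Set.Ioo (0 : ℝ) 1)).withDensityᵥ
      (fun t : ℝ => ((jacobiDensity α β k t i j : ℝ) : ℂ)) := rfl

theorem jacobiWeight_integrable (hα : -1 < α) (hβ : -1 < β) (p : ℂ[X]) (i j : Fin 2) :
    (jacobiWeight α β k i j).Integrable fun t : ℝ => p.eval (t : ℂ) := by
  refine integrable_withDensityᵥ (jacobiWeight_integrable_density hα hβ i j) ?_
    (continuous_eval_ofReal p).measurable
  simp only [jacobiDensity_eq, ← mul_assoc, ← eval_mul]
  exact integrable_mul_jacobiScalar hα hβ (continuous_eval_ofReal _)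

theorem jacobiWeight_hasMoments (hα : -1 < α) (hβ : -1 < β) (i j : Fin 2) :
    HasMoments (jacobiWeight α β k i j) := fun n => by
  simpa using jacobiWeight_integrable (k := k) hα hβ (X ^ n) i j

theorem polyIntegral_jacobiWeight (hα : -1 < α) (hβ : -1 < β) (p : ℂ[X]) (i j : Fin 2) :
    polyIntegral (jacobiWeight α β k i j) p = jacobiInt hα hβ (p * jacobiPoly β k i j) := by
  have hint := jacobiWeight_integrable (k := k) hα hβ p i j
  rw [jacobiWeight_apply] at hint
  rw [polyIntegral, jacobiWeight_apply, integral_withDensityᵥ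
    (jacobiWeight_integrable_density hα hβ i j) hint, jacobiInt_apply]
  simp only [jacobiDensity_eq, ← mul_assoc, ← eval_mul]

theorem jacobiWeight_variation_eq_zero (hα : -1 < α) (hβ : -1 < β) (i j : Fin 2) {s : Set ℝ}
    (hs : MeasurableSet s) (h : Disjoint s (Set.Ioo 0 1)) :
    (jacobiWeight α β k i j).variation s = 0 := by
  have := Measure.variation_withDensityᵥ
    (jacobiWeight_integrable_density (k := k) hα hβ i j)
  rw [jacobiWeight_apply, this]
  refine withDensity_absolutelyContinuous _ _ ?_
  rw [Measure.restrict_apply hs, h.inter_eq, measure_empty]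

/-- The quadratic form `∫ (p₁, p₂) dW (p₁, p₂)*` for the Jacobi weight matrix. -/
theorem jacobiWeight_quadratic (hα : -1 < α) (hβ : -1 < β) (p : Fin 2 → ℂ[X]) :
    ∑ i, ∑ j, polyIntegral (jacobiWeight α β k i j) (p i * (p j).map (starRingEnd ℂ)) =
      ((∫ t in Set.Ioo (0 : ℝ) 1, (k * t ^ 2 * ‖(p 0).eval (t : ℂ)‖ ^ 2 + (β - k + 1) *
        ‖(p 0 + (1 - X) * p 1).eval (t : ℂ)‖ ^ 2) * jacobiScalar α β t : ℝ) : ℂ) := by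
  -- The polynomial part of the density is `k t² e₁ e₁ᵀ + (β - k + 1) w wᵀ` with `e₁ = (1, 0)` and
  -- `w = (1, 1 - t)`.
  simp only [polyIntegral_jacobiWeight hα hβ, ← map_sum]
  rw [jacobiInt_apply, ← integral_complex_ofReal]
  refine integral_congr_ae (Filter.Eventually.of_forall fun t => ?_)
  have hn (z : ℂ) : ((‖z‖ ^ 2 : ℝ) : ℂ) = z * starRingEnd ℂ z := by
    rw [Complex.mul_conj, Complex.normSq_eq_norm_sq]
  beta_reduce
  simp only [Complex.ofReal_mul, Complex.ofReal_add, hn]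
  simp only [Fin.sum_univ_two, eval_map_conj, jacobiPoly, eval_add, eval_mul, map_add, map_mul]
  congr 1
  simp
  ring

end

section

/-! ### Weight matrices of the form `γ W + ζ δ M` -/

variable {α β k : ℝ}

/-- For a real symmetric matrix the Hermitian form is the sum of the real forms of the real and
imaginary parts. -/
theorem posSemidef_map_ofReal {A : Matrix (Fin 2) (Fin 2) ℝ} (hs : A 1 0 = A 0 1)
    (h : ∀ u v : ℝ, 0 ≤ A 0 0 * u ^ 2 + 2 * A 0 1 * u * v + A 1 1 * v ^ 2) :
    (A.map fun x : ℝ => (x : ℂ)).PosSemidef := by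
  refine Matrix.PosSemidef.of_dotProduct_mulVec_nonneg ?_ fun x => ?_
  · ext i j
    fin_cases i <;> fin_cases j <;> simp [hs]
  · have e : star x ⬝ᵥ ((A.map fun x : ℝ => (x : ℂ)).mulVec x) =
        ((A 0 0 * (x 0).re ^ 2 + 2 * A 0 1 * (x 0).re * (x 1).re + A 1 1 * (x 1).re ^ 2
          + (A 0 0 * (x 0).im ^ 2 + 2 * A 0 1 * (x 0).im * (x 1).im + A 1 1 * (x 1).im ^ 2) : ℝ)
          : ℂ) := by
      apply Complex.ext <;>
        simp [dotProduct, Matrix.mulVec, Fin.sum_univ_two, hs, pow_two] <;> ring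
    rw [e]
    exact_mod_cast add_nonneg (h _ _) (h _ _)

theorem posSemidef_massOf_jacobiWeight (hα : -1 < α) (hβ : -1 < β) (hk : 0 < k) (hkβ : k < β + 1)
    {s : Set ℝ} (hs : MeasurableSet s) : (massOf (jacobiWeight α β k) s).PosSemidef := by
  set μ := (volume.restrict (Set.Ioo (0 : ℝ) 1)).restrict s with hμ
  have hint (i j : Fin 2) : Integrable (fun t => jacobiDensity α β k t i j) μ :=
    (jacobiWeight_integrable_density (k := k) hα hβ i j).re.restrict
  have e : massOf (jacobiWeight α β k) s =
      (Matrix.of fun i j => ∫ t, jacobiDensity α β k t i j ∂μ).map fun x : ℝ => (x : ℂ) := by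
    ext i j
    rw [massOf, Matrix.of_apply, jacobiWeight_apply,
      withDensityᵥ_apply (jacobiWeight_integrable_density hα hβ i j) hs]
    simp [integral_complex_ofReal, hμ]
  rw [e]
  refine posSemidef_map_ofReal ?_ fun u v => ?_
  · simp [jacobiDensity]
  · simp only [Matrix.of_apply]
    have e2 : (∫ t, jacobiDensity α β k t 0 0 ∂μ) * u ^ 2 +
        2 * (∫ t, jacobiDensity α β k t 0 1 ∂μ) * u * v +
        (∫ t, jacobiDensity α β k t 1 1 ∂μ) * v ^ 2 =
        ∫ t, (jacobiDensity α β k t 0 0 * u ^ 2 + jacobiDensity α β k t 0 1 * (2 * u * v) +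
        jacobiDensity α β k t 1 1 * v ^ 2) ∂μ := by
      have h01 : Integrable (fun t => jacobiDensity α β k t 0 0 * u ^ 2 +
          jacobiDensity α β k t 0 1 * (2 * u * v)) μ :=
        ((hint 0 0).mul_const _).add ((hint 0 1).mul_const _)
      rw [integral_add h01 ((hint 1 1).mul_const _),
        integral_add ((hint 0 0).mul_const _) ((hint 0 1).mul_const _),
        integral_mul_const, integral_mul_const, integral_mul_const]
      ring
    rw [e2]
    refine integral_nonneg_of_ae ?_
    filter_upwards [ae_restrict_of_ae (ae_restrict_mem measurableSet_Ioo)] with t ht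
    have hω := (jacobiScalar_pos (α := α) (β := β) ht).le
    have e3 : jacobiDensity α β k t 0 0 * u ^ 2 + jacobiDensity α β k t 0 1 * (2 * u * v) +
        jacobiDensity α β k t 1 1 * v ^ 2 = jacobiScalar α β t *
        (k * (t * u) ^ 2 + (β + 1 - k) * (u + (1 - t) * v) ^ 2) := by
      simp [jacobiDensity, jacobiScalar]
      ring
    have : 0 < β + 1 - k := by linarith
    rw [e3, Pi.zero_apply]
    positivity

theorem posSemidef_massOf_pointMass {N : ℕ} (t₀ : ℝ) {M : Matrix (Fin N) (Fin N) ℂ}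
    (hM : M.PosSemidef) {s : Set ℝ} (hs : MeasurableSet s) :
    (massOf (pointMass t₀ M) s).PosSemidef := by
  by_cases h : t₀ ∈ s
  · convert hM
    ext i j
    simp [massOf, pointMass, VectorMeasure.dirac_apply_of_mem hs h]
  · convert! Matrix.PosSemidef.zero
    ext i j
    simp [massOf, pointMass, VectorMeasure.dirac_apply_of_notMem h]

theorem pointMass_hasMoments {N : ℕ} (t₀ : ℝ) (M : Matrix (Fin N) (Fin N) ℂ) (i j : Fin N) :
    HasMoments (pointMass t₀ M i j) := HasMoments.dirac t₀ (M i j)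

theorem combination_hasMoments (hα : -1 < α) (hβ : -1 < β) (t₀ γ ζ : ℝ)
    (M : Matrix (Fin 2) (Fin 2) ℂ) (i j : Fin 2) :
    HasMoments ((γ • jacobiWeight α β k + ζ • pointMass t₀ M) i j) :=
  ((jacobiWeight_hasMoments hα hβ i j).smul γ).add ((pointMass_hasMoments t₀ M i j).smul ζ)

theorem combination_variation_eq_zero (hα : -1 < α) (hβ : -1 < β) (t₀ γ ζ : ℝ)
    (M : Matrix (Fin 2) (Fin 2) ℂ) (i j : Fin 2) :
    ((γ • jacobiWeight α β k + ζ • pointMass t₀ M) i j).variation {t | |t₀| + 2 ≤ |t|} = 0 := by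
  have hs : MeasurableSet {t : ℝ | |t₀| + 2 ≤ |t|} :=
    measurableSet_le measurable_const measurable_norm
  have h1 := jacobiWeight_variation_eq_zero (k := k) hα hβ i j hs (by
    rw [Set.disjoint_left]
    intro t (ht : |t₀| + 2 ≤ |t|) ht'
    rw [abs_of_pos ht'.1] at ht
    linarith [abs_nonneg t₀, ht'.2])
  have h2 : (pointMass t₀ M i j).variation {t | |t₀| + 2 ≤ |t|} = 0 := by
    rw [pointMass, Matrix.of_apply, VectorMeasure.variation_dirac, Measure.smul_apply,
      Measure.dirac_apply' _ hs]
    simp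
  refine le_antisymm ((VectorMeasure.variation_add_le _).trans ?_) (zero_le)
  simp only [Measure.add_apply]
  have e1 : (γ • jacobiWeight α β k) i j = γ • jacobiWeight α β k i j := rfl
  have e2 : (ζ • pointMass t₀ M) i j = ζ • pointMass t₀ M i j := rfl
  rw [e1, e2, VectorMeasure.variation_smul, VectorMeasure.variation_smul]
  simp [h1, h2]

theorem polyIntegral_combination (hα : -1 < α) (hβ : -1 < β) (t₀ γ ζ : ℝ)
    (M : Matrix (Fin 2) (Fin 2) ℂ) (i j : Fin 2) (p : ℂ[X]) :
    polyIntegral ((γ • jacobiWeight α β k + ζ • pointMass t₀ M) i j) p =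
      γ * polyIntegral (jacobiWeight α β k i j) p + ζ * (p.eval (t₀ : ℂ) * M i j) := by
  rw [← polyIntegral_dirac, ← polyIntegral_smul_measure, ← polyIntegral_smul_measure]
  exact polyIntegral_add_measure ((jacobiWeight_hasMoments hα hβ i j).smul γ)
    ((pointMass_hasMoments t₀ M i j).smul ζ) p

theorem innerForm_self_quadratic {W : MatrixMeasure 2} (hW : ∀ i j, HasMoments (W i j))
    (P : MatrixPoly 2) (v : Fin 2 → ℂ) :
    ∑ k, ∑ l, polyIntegral (W k l)
      ((∑ i, C (v i) * P i k) * (∑ j, C (v j) * P j l).map (starRingEnd ℂ)) =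
      Matrix.vecMul v (innerForm W P P) ⬝ᵥ star v := by
  simp only [← (hW _ _).functional_apply, Matrix.vecMul, dotProduct, innerForm_apply,
    Fin.sum_univ_two, Polynomial.map_add, Polynomial.map_mul, map_C, add_mul, mul_add, map_add]
  have e (i j : Fin 2) (a b : ℂ) (p q : ℂ[X]) : (hW i j).functional (C a * p * (C b * q)) =
      a * (b * (hW i j).functional (p * q)) := by
    rw [show C a * p * (C b * q) = a • b • (p * q) by simp only [smul_eq_C_mul]; ring,
      map_smul, map_smul]
    rfl
  simp only [e, Pi.star_apply, starRingEnd_apply]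
  ring

/-- If `v` is in the left kernel of `∫ P dW P*`, the row `v P` has zero quadratic form. Both
contributions are nonnegative, so the Jacobi part vanishes; its density is positive definite on `(0,
1)`, which forces `v P = 0`, and then `v` annihilates the leading coefficient of `P`. -/
theorem isWeightMatrix_combination (hα : -1 < α) (hβ : -1 < β) (hk : 0 < k) (hkβ : k < β + 1)
    (t₀ : ℝ) {γ ζ : ℝ} (hγ : 0 < γ) (hζ : 0 ≤ ζ) {M : Matrix (Fin 2) (Fin 2) ℂ}
    (hM : M.PosSemidef) : IsWeightMatrix (γ • jacobiWeight α β k + ζ • pointMass t₀ M) where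
  posSemidef s hs := by
    have e : massOf (γ • jacobiWeight α β k + ζ • pointMass t₀ M) s =
        γ • massOf (jacobiWeight α β k) s + ζ • massOf (pointMass t₀ M) s := rfl
    rw [e]
    exact ((posSemidef_massOf_jacobiWeight hα hβ hk hkβ hs).smul hγ.le).add
      ((posSemidef_massOf_pointMass t₀ hM hs).smul hζ)
  moments n i j := combination_hasMoments hα hβ t₀ γ ζ M i j n
  nonsingular n P hP hdet := by
    intro h0
    obtain ⟨v, hv, hv0⟩ := Matrix.exists_vecMul_eq_zero_iff.2 h0
    have hq := innerForm_self_quadratic (combination_hasMoments (k := k) hα hβ t₀ γ ζ M) P v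
    rw [hv0, zero_dotProduct] at hq
    set p : Fin 2 → ℂ[X] := fun k => ∑ i, C (v i) * P i k with hp
    set f : ℝ → ℝ := fun t => (k * t ^ 2 * ‖(p 0).eval (t : ℂ)‖ ^ 2 + (β - k + 1) *
        ‖(p 0 + (1 - X) * p 1).eval (t : ℂ)‖ ^ 2) * jacobiScalar α β t with hf
    have hsplit : ∑ i, ∑ j, polyIntegral ((γ • jacobiWeight α β k + ζ • pointMass t₀ M) i j)
        (p i * (p j).map (starRingEnd ℂ)) =
        γ * ((∫ t in Set.Ioo (0 : ℝ) 1, f t : ℝ) : ℂ) +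
        ζ * (star (fun i => star ((p i).eval (t₀ : ℂ))) ⬝ᵥ
          M.mulVec fun i => star ((p i).eval (t₀ : ℂ))) := by
      rw [← jacobiWeight_quadratic hα hβ p]
      simp only [polyIntegral_combination hα hβ, Fin.sum_univ_two, dotProduct, Matrix.mulVec,
        eval_mul, eval_map_conj, Pi.star_apply, star_star, starRingEnd_apply]
      ring
    have hc : 0 < β - k + 1 := by linarith
    have hfnn : ∀ t ∈ Set.Ioo (0 : ℝ) 1, 0 ≤ f t := fun t ht => by
      have := (jacobiScalar_pos (α := α) (β := β) ht).le
      positivity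
    have hfint : IntegrableOn f (Set.Ioo 0 1) := by
      have := (integrable_mul_jacobiScalar hα hβ (f := fun t : ℝ => ((k * t ^ 2 *
        ‖(p 0).eval (t : ℂ)‖ ^ 2 + (β - k + 1) * ‖(p 0 + (1 - X) * p 1).eval (t : ℂ)‖ ^ 2 : ℝ) : ℂ))
        (by
          have h1 := continuous_eval_ofReal (p 0)
          have h2 := continuous_eval_ofReal (p 0 + (1 - X) * p 1)
          fun_prop)).re
      refine this.congr (Filter.Eventually.of_forall fun t => ?_)
      simp only [← Complex.ofReal_mul]
      rfl
    have hI0 : ∫ t in Set.Ioo (0 : ℝ) 1, f t = 0 := by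
      rw [hsplit] at hq
      have h2 := Complex.le_def.1 (hM.dotProduct_mulVec_nonneg
        fun i => star ((p i).eval (t₀ : ℂ)))
      have h3 := congrArg Complex.re hq
      have h4 : 0 ≤ ∫ t in Set.Ioo (0 : ℝ) 1, f t := setIntegral_nonneg measurableSet_Ioo hfnn
      rw [Complex.add_re, Complex.re_ofReal_mul, Complex.re_ofReal_mul, Complex.ofReal_re,
        Complex.zero_re] at h3
      have h5 : 0 ≤ ζ * (star (fun i => star ((p i).eval (t₀ : ℂ))) ⬝ᵥ
          M.mulVec fun i => star ((p i).eval (t₀ : ℂ))).re := mul_nonneg hζ h2.1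
      have h6 : γ * ∫ t in Set.Ioo (0 : ℝ) 1, f t = 0 :=
        le_antisymm (by linarith) (by positivity)
      exact (mul_eq_zero.1 h6).resolve_left hγ.ne'
    have hae : ∀ᵐ t : ℝ ∂volume.restrict (Set.Ioo (0 : ℝ) 1),
        (p 0).eval (t : ℂ) = 0 ∧ (p 1).eval (t : ℂ) = 0 := by
      have h1 := (setIntegral_eq_zero_iff_of_nonneg_ae
        ((ae_restrict_iff' measurableSet_Ioo).2 (Filter.Eventually.of_forall hfnn)) hfint).1 hI0
      filter_upwards [h1, ae_restrict_mem measurableSet_Ioo] with t ht ht'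
      have hω := jacobiScalar_pos (α := α) (β := β) ht'
      have h2 : k * t ^ 2 * ‖(p 0).eval (t : ℂ)‖ ^ 2 + (β - k + 1) *
        ‖(p 0 + (1 - X) * p 1).eval (t : ℂ)‖ ^ 2 = 0 :=
        (mul_eq_zero.1 ht).resolve_right hω.ne'
      have ht0 : 0 < t := ht'.1
      rw [add_eq_zero_iff_of_nonneg (by positivity) (by positivity)] at h2
      have h3 : (p 0).eval (t : ℂ) = 0 := by
        simpa [hk.ne', ht0.ne'] using h2.1
      refine ⟨h3, ?_⟩
      have h4 : (p 0 + (1 - X) * p 1).eval (t : ℂ) = 0 := by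
        simpa [hc.ne'] using h2.2
      rw [eval_add, h3, zero_add, eval_mul] at h4
      refine (mul_eq_zero.1 h4).resolve_left ?_
      simp only [eval_sub, eval_one, eval_X]
      exact_mod_cast (sub_pos.2 ht'.2).ne'
    have hpz : ∀ i, p i = 0 := by
      have hinf (q : ℂ[X]) (hq : ∀ᵐ t : ℝ ∂volume.restrict (Set.Ioo (0 : ℝ) 1), q.eval (t : ℂ) = 0) :
          q = 0 := by
        by_contra hne
        have hfin : {t : ℝ | q.eval (t : ℂ) = 0}.Finite := by
          refine (q.roots.toFinset.finite_toSet.preimage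
            (Complex.ofReal_injective.injOn)).subset fun t ht => ?_
          simpa [hne] using ht
        have h1 : volume.restrict (Set.Ioo (0 : ℝ) 1) {t : ℝ | q.eval (t : ℂ) = 0} = 0 :=
          le_antisymm ((Measure.restrict_le_self _).trans_eq (hfin.measure_zero _)) zero_le
        have h2 : volume.restrict (Set.Ioo (0 : ℝ) 1) Set.univ = 0 := by
          refine measure_mono_null (t := {t : ℝ | q.eval (t : ℂ) = 0} ∪
            {t : ℝ | ¬ q.eval (t : ℂ) = 0}) (fun t _ => em _) (measure_union_null h1 hq)
        simp at h2
      intro i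
      refine hinf _ ?_
      filter_upwards [hae] with t ht
      fin_cases i <;> simp [ht]
    refine hdet (Matrix.exists_vecMul_eq_zero_iff.1 ⟨v, hv, ?_⟩)
    ext i
    have := congrArg (fun q => q.coeff n) (hpz i)
    simpa [hp, Matrix.vecMul, dotProduct, finsetSum_coeff] using this

end

section

/-! ### The second order operators symmetric with respect to the Jacobi weight matrix -/

/-- The coefficient `F₂` of the operators with parameters `s, p, z`; here `a = α + 1` and
`c = β - k + 1`. -/
def jacobiF₂ (c k s p z : ℝ) : MatrixPoly 2 :=
  !![(1 - X) * (-(C (c : ℂ) * C (s : ℂ)) + (C (z : ℂ) + C (p : ℂ)) * X),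
     C (c : ℂ) * C (s : ℂ) - C (p : ℂ) * X - C (s : ℂ) * C (k : ℂ) * X ^ 2;
     -(C (c : ℂ) * C (s : ℂ)) * (1 - X) ^ 2,
     (1 - X) * (C (c : ℂ) * C (s : ℂ) + C (z : ℂ) * X)]

/-- The coefficient `F₁` of the operators with parameters `s, p, z`. -/
def jacobiF₁ (a c k s p z : ℝ) : MatrixPoly 2 :=
  !![C ((2 * c * k * s + p * (a + c + 2) + z * (a + 2) : ℝ) : ℂ)
       - C (((p + z) * (a + c + k + 2) : ℝ) : ℂ) * X,
     C ((-2 * c * k * s - p * (a + c + 2) - 2 * z : ℝ) : ℂ)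
       - C ((2 * k * s * (a + c + 1) - p * k : ℝ) : ℂ) * X;
     C ((c * (2 * (k + 1) * s + p) : ℝ) : ℂ) * (1 - X),
     C ((z * a - c * (2 * (k + 1) * s + p) : ℝ) : ℂ) - C ((z * (a + c + k + 2) : ℝ) : ℂ) * X]

/-- The real form of the coefficient `F₀` of the operators with parameters `s, p, z`. -/
def jacobiF₀ (a c k s p z : ℝ) : Matrix (Fin 2) (Fin 2) ℝ :=
  !![c * k * s * (a + c - k) - p * k * (a + 2 * c + 1) / 2 + z * (a + c - k) / 2,
     -k * s * ((a + c + 1) * (a + c - k) + k * (a + 1)) + p * k * (a + c + 1) + z * k;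
     c * k * s * (c - k - 1) - p * c * k + z * c,
     -(c * k * s * (a + c - k) - p * k * (a + 2 * c + 1) / 2 + z * (a + c - k) / 2)]

/-- The operators with parameters `s, p, z`. -/
def jacobiOp (a c k s p z : ℝ) : DiffOp 2 where
  F₂ := jacobiF₂ c k s p z
  F₁ := jacobiF₁ a c k s p z
  F₀ := (jacobiF₀ a c k s p z).map fun x : ℝ => (x : ℂ)
  deg₂ := by
    intro i j
    fin_cases i <;> fin_cases j <;> simp [jacobiF₂] <;> compute_degree
  deg₁ := by
    intro i j
    fin_cases i <;> fin_cases j <;> simp only [jacobiF₁, Fin.zero_eta, Fin.mk_one,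
      Fin.isValue, Matrix.of_apply, Matrix.cons_val', Matrix.cons_val_zero,
      Matrix.cons_val_one, Matrix.cons_val_fin_one] <;> compute_degree

theorem DiffOp.isReal_of_map_conj {N : ℕ} {D : DiffOp N}
    (h2 : ∀ i j, (D.F₂ i j).map (starRingEnd ℂ) = D.F₂ i j)
    (h1 : ∀ i j, (D.F₁ i j).map (starRingEnd ℂ) = D.F₁ i j)
    (h0 : ∀ i j, starRingEnd ℂ (D.F₀ i j) = D.F₀ i j) : D.IsReal := by
  have e (q : ℂ[X]) (hq : q.map (starRingEnd ℂ) = q) (n : ℕ) : (q.coeff n).im = 0 := by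
    rw [← Complex.conj_eq_iff_im, ← coeff_map, hq]
  exact fun i j => ⟨e _ (h2 i j), e _ (h1 i j), Complex.conj_eq_iff_im.1 (h0 i j)⟩

theorem jacobiOp_F₂_conj (a c k s p z : ℝ) (i j : Fin 2) :
    ((jacobiOp a c k s p z).F₂ i j).map (starRingEnd ℂ) = (jacobiOp a c k s p z).F₂ i j := by
  fin_cases i <;> fin_cases j <;> simp [jacobiOp, jacobiF₂]

theorem jacobiOp_F₁_conj (a c k s p z : ℝ) (i j : Fin 2) :
    ((jacobiOp a c k s p z).F₁ i j).map (starRingEnd ℂ) = (jacobiOp a c k s p z).F₁ i j := by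
  fin_cases i <;> fin_cases j <;>
    simp only [jacobiOp, jacobiF₁, Fin.zero_eta, Fin.mk_one, Fin.isValue, Matrix.of_apply,
      Matrix.cons_val', Matrix.cons_val_zero, Matrix.cons_val_one, Matrix.cons_val_fin_one,
      Polynomial.map_sub, Polynomial.map_mul, map_C, map_X, Polynomial.map_one,
      Complex.conj_ofReal]

theorem jacobiOp_isReal (a c k s p z : ℝ) : (jacobiOp a c k s p z).IsReal :=
  DiffOp.isReal_of_map_conj (jacobiOp_F₂_conj a c k s p z) (jacobiOp_F₁_conj a c k s p z)
    fun i j => by simp [jacobiOp]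

theorem DiffOp.apply_apply {N : ℕ} (D : DiffOp N) (P : MatrixPoly N) (i j : Fin N) :
    D.apply P i j = ∑ m, (derivative (derivative (P i m)) * D.F₂ m j
      + derivative (P i m) * D.F₁ m j + P i m * C (D.F₀ m j)) := by
  simp [DiffOp.apply, Matrix.mul_apply, Finset.sum_add_distrib]

theorem jacobiOp_apply_conj (a c k s p z : ℝ) (P : MatrixPoly 2) (i j : Fin 2) :
    ((jacobiOp a c k s p z).apply P i j).map (starRingEnd ℂ) =
      (jacobiOp a c k s p z).apply (P.map fun q => q.map (starRingEnd ℂ)) i j := by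
  have h0 (m : Fin 2) : starRingEnd ℂ ((jacobiOp a c k s p z).F₀ m j) =
      (jacobiOp a c k s p z).F₀ m j := by simp [jacobiOp]
  simp only [DiffOp.apply_apply, Polynomial.map_sum, Polynomial.map_add, Polynomial.map_mul,
    map_C, jacobiOp_F₂_conj, jacobiOp_F₁_conj, h0, derivative_map, Matrix.map_apply]

/-- The boundary form of the operators with parameters `s, p, z`: for row vectors `u`, `v` of
polynomials, `(u D) R vᵀ - u R (v D)ᵀ` is its image under the Pearson operator. -/
def jacobiBoundary (a c k s p z : ℝ) (u v : Fin 2 → ℂ[X]) : ℂ[X] :=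
  let H₁ : ℂ[X] := C ((z * c : ℝ) : ℂ) - C ((2 * c * k * s : ℝ) : ℂ) * X
    + C (((z + p) * k : ℝ) : ℂ) * X ^ 2
  let H₂ : ℂ[X] := C (c : ℂ) * (1 - X) * (C (z : ℂ) - C ((k * s : ℝ) : ℂ) * X)
  let H₃ : ℂ[X] := C ((c * z : ℝ) : ℂ) * (1 - X) ^ 2
  let η : ℂ[X] := C ((z * c - c * k * s * (a + 1) : ℝ) : ℂ)
    + C ((c * k * (s * (a + c - k) - p) : ℝ) : ℂ) * X
  derivative (u 0) * (H₁ * v 0 + H₂ * v 1) + derivative (u 1) * (H₂ * v 0 + H₃ * v 1)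
    - (u 0 * (H₁ * derivative (v 0) + H₂ * derivative (v 1))
      + u 1 * (H₂ * derivative (v 0) + H₃ * derivative (v 1)))
    + η * (u 0 * v 1 - u 1 * v 0)

/-- Integrated against the scalar Jacobi weight, the right-hand side vanishes by
`jacobiInt_pearson`; this is the source of symmetry for all `s, p, z`. -/
theorem jacobiOp_lagrange (α β k s p z : ℝ) (P Q : MatrixPoly 2) (i j : Fin 2) :
    ∑ m, ∑ l, ((jacobiOp (α + 1) (β - k + 1) k s p z).apply P i m * Q j l * jacobiPoly β k m l
      - P i m * (jacobiOp (α + 1) (β - k + 1) k s p z).apply Q j l * jacobiPoly β k m l) =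
    X * (1 - X) * derivative (jacobiBoundary (α + 1) (β - k + 1) k s p z (P i) (Q j)) +
      (C ((α + 1 : ℝ) : ℂ) * (1 - X) - C ((β + 1 : ℝ) : ℂ) * X) *
        jacobiBoundary (α + 1) (β - k + 1) k s p z (P i) (Q j) := by
  obtain ⟨a, rfl⟩ : ∃ a, α = a - 1 := ⟨α + 1, by ring⟩
  obtain ⟨c, rfl⟩ : ∃ c, β = c + k - 1 := ⟨β - k + 1, by ring⟩
  have e1 : a - 1 + 1 = a := by ring
  have e2 : c + k - 1 - k + 1 = c := by ring
  have e3 : c + k - 1 + 1 = c + k := by ring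
  simp only [DiffOp.apply_apply, Fin.sum_univ_two, jacobiOp, jacobiPoly, jacobiBoundary, e1, e2, e3]
  generalize P i 0 = u₀
  generalize P i 1 = u₁
  generalize Q j 0 = v₀
  generalize Q j 1 = v₁
  refine Polynomial.funext fun t => ?_
  simp only [jacobiF₂, jacobiF₁, jacobiF₀, Matrix.of_apply, Matrix.map_apply,
    Matrix.cons_val', Matrix.cons_val_zero, Matrix.cons_val_one, Matrix.cons_val_fin_one,
    derivative_add, derivative_sub, derivative_mul, derivative_pow, derivative_C, derivative_X,
    derivative_one, eval_add, eval_sub, eval_mul, eval_neg, eval_pow, eval_C, eval_X, eval_one,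
    eval_zero]
  norm_num only [Nat.cast_ofNat, pow_one]
  push_cast
  -- After evaluation the functions and their derivatives are independent scalars, and a plain ring
  -- identity remains.
  generalize eval t (derivative (derivative u₀)) = u₀''
  generalize eval t (derivative (derivative u₁)) = u₁''
  generalize eval t (derivative (derivative v₀)) = v₀''
  generalize eval t (derivative (derivative v₁)) = v₁''
  ring1

end

section

/-- The operator is real, so it commutes with conjugating `Q`; the Lagrange identity then applies to
`P` and the conjugate of `Q`. -/
theorem jacobiOp_isSymmetric {α β : ℝ} (hα : -1 < α) (hβ : -1 < β) (k s p z : ℝ) :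
    (jacobiOp (α + 1) (β - k + 1) k s p z).IsSymmetric (jacobiWeight α β k) := by
  intro P Q
  ext i j
  rw [innerForm_apply, innerForm_apply, ← sub_eq_zero]
  simp only [polyIntegral_jacobiWeight hα hβ, jacobiOp_apply_conj, ← Finset.sum_sub_distrib,
    ← map_sub, ← map_sum]
  have := jacobiOp_lagrange α β k s p z P (Q.map fun q => q.map (starRingEnd ℂ)) i j
  simp only [Matrix.map_apply] at this
  rw [this, jacobiInt_pearson]

theorem coeff_two_quadratic (a b c : ℂ) : (C a + C b * X + C c * X ^ 2).coeff 2 = c := by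
  simp

theorem coeff_one_linear (a b : ℂ) : (C a + C b * X).coeff 1 = b := by
  simp [coeff_C]

theorem jacobiOp_leadingPencil (a c k s p z : ℝ) (n : ℕ) :
    (jacobiOp a c k s p z).leadingPencil n =
      (!![-(n + (a + c + k + 2)) * (z + p), -n * k * s - 2 * k * s * (a + c + 1) + p * k;
          -n * c * s - c * (2 * (k + 1) * s + p), -(n + (a + c + k + 2)) * z] :
        Matrix (Fin 2) (Fin 2) ℝ).map fun x : ℝ => (x : ℂ) := by
  have h00 : (jacobiF₂ c k s p z 0 0) = C (-(c * s : ℂ)) + C (c * s + z + p : ℂ) * X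
      + C (-(z + p) : ℂ) * X ^ 2 := by
    simp [jacobiF₂]; ring
  have h01 : (jacobiF₂ c k s p z 0 1) = C (c * s : ℂ) + C (-p : ℂ) * X
      + C (-(s * k) : ℂ) * X ^ 2 := by
    simp [jacobiF₂]; ring
  have h10 : (jacobiF₂ c k s p z 1 0) = C (-(c * s : ℂ)) + C (c * s + c * s : ℂ) * X
      + C (-(c * s) : ℂ) * X ^ 2 := by
    simp [jacobiF₂]; ring
  have h11 : (jacobiF₂ c k s p z 1 1) = C (c * s : ℂ) + C (z - c * s : ℂ) * X
      + C (-z : ℂ) * X ^ 2 := by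
    simp [jacobiF₂]; ring
  have e (x y : ℝ) : C (x : ℂ) - C (y : ℂ) * X = C (x : ℂ) + C (-y : ℂ) * X := by simp; ring
  have e' (x : ℝ) : C (x : ℂ) * (1 - X) = C (x : ℂ) + C (-x : ℂ) * X := by simp; ring
  ext i j
  simp only [DiffOp.leadingPencil, Matrix.of_apply, Matrix.map_apply, jacobiOp]
  fin_cases i <;> fin_cases j
  · simp only [Fin.zero_eta, Fin.isValue, h00, coeff_two_quadratic]
    simp only [jacobiF₁, Matrix.of_apply, Matrix.cons_val', Matrix.cons_val_zero,
      Matrix.cons_val_fin_one, e, coeff_one_linear]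
    push_cast; ring
  · simp only [Fin.zero_eta, Fin.mk_one, Fin.isValue, h01, coeff_two_quadratic]
    simp only [jacobiF₁, Matrix.of_apply, Matrix.cons_val', Matrix.cons_val_zero,
      Matrix.cons_val_one, Matrix.cons_val_fin_one, e, coeff_one_linear]
    push_cast; ring
  · simp only [Fin.zero_eta, Fin.mk_one, Fin.isValue, h10, coeff_two_quadratic]
    simp only [jacobiF₁, Matrix.of_apply, Matrix.cons_val', Matrix.cons_val_zero,
      Matrix.cons_val_one, Matrix.cons_val_fin_one, e', coeff_one_linear]
    push_cast; ring
  · simp only [Fin.mk_one, Fin.isValue, h11, coeff_two_quadratic]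
    simp only [jacobiF₁, Matrix.of_apply, Matrix.cons_val',
      Matrix.cons_val_one, Matrix.cons_val_fin_one, e, coeff_one_linear]
    push_cast; ring

/-! ### Operators with an additional point mass -/

/-- The operator which admits a point mass at `t₀`. -/
def massOp (a c k t₀ q : ℝ) : DiffOp 2 := jacobiOp a c k t₀ ((a + c - k) * t₀ - a) (q - c)

/-- The mass `[[1, φ], [φ, φ²]]`. -/
def massMatrix (φ : ℝ) : Matrix (Fin 2) (Fin 2) ℂ :=
  (!![1, φ; φ, φ ^ 2] : Matrix (Fin 2) (Fin 2) ℝ).map fun x : ℝ => (x : ℂ)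

theorem massMatrix_eq_vecMulVec (φ : ℝ) :
    massMatrix φ = Matrix.vecMulVec ![1, (φ : ℂ)] (star ![1, (φ : ℂ)]) := by
  ext i j
  fin_cases i <;> fin_cases j <;> simp [massMatrix, Matrix.vecMulVec_apply, pow_two]

theorem massMatrix_posSemidef (φ : ℝ) : (massMatrix φ).PosSemidef := by
  rw [massMatrix_eq_vecMulVec]
  exact Matrix.posSemidef_vecMulVec_self_star _

theorem massMatrix_rank (φ : ℝ) : (massMatrix φ).rank = 1 := by
  refine le_antisymm ?_ (Nat.one_le_iff_ne_zero.2 fun h => ?_)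
  · rw [massMatrix_eq_vecMulVec]
    exact Matrix.rank_vecMulVec_le _ _
  · rw [Matrix.rank, Submodule.finrank_eq_zero, LinearMap.range_eq_bot] at h
    simpa [massMatrix] using congrFun (LinearMap.congr_fun h (Pi.single 0 1)) 0

variable {a c k t₀ q φ : ℝ}

/-- The relations between the parameters `t₀`, `q` and `φ`. -/
structure MassRelations (a c k t₀ q φ : ℝ) : Prop where
  mul_eq : q * φ = c * (1 - t₀)
  add_eq : (a + c + k * t₀) * φ + ((a + c - k) * t₀ - a - 2 * c) + q = 0

theorem MassRelations.massConstraints (h : MassRelations a c k t₀ q φ) :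
    MassConstraints (massOp a c k t₀ q) t₀ (massMatrix φ) := by
  have h1 : (q : ℂ) * φ = c * (1 - t₀) := by exact_mod_cast h.mul_eq
  have h2 : ((a : ℂ) + c + k * t₀) * φ + ((a + c - k) * t₀ - a - 2 * c) + q = 0 := by
    exact_mod_cast h.add_eq
  have key (A : Matrix (Fin 2) (Fin 2) ℂ) (hA : ∀ i, A i 0 + A i 1 * φ = 0) :
      A * massMatrix φ = 0 := by
    ext i j
    rw [Matrix.mul_apply]
    fin_cases j
    · simpa [Fin.sum_univ_two, massMatrix] using hA i
    · simp only [Fin.sum_univ_two, massMatrix]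
      simp
      linear_combination (φ : ℂ) * hA i
  refine ⟨key _ fun i => ?_, key _ fun i => ?_, ?_⟩
  -- The choice of `p` makes the upper right entry of `F₂(t₀)` equal to `t₀ (1 - t₀) (a + c + k
  -- t₀)`, and `z = q - c` makes the lower right one `q t₀ (1 - t₀)`. Each row applied to `(1, φ)`
  -- is then a multiple of one relation.
  · fin_cases i
    · simp [massOp, jacobiOp, jacobiF₂]
      linear_combination (t₀ * (1 - t₀)) * h2
    · simp [massOp, jacobiOp, jacobiF₂]
      linear_combination (t₀ * (1 - t₀)) * h1
  · fin_cases i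
    · simp [massOp, jacobiOp, jacobiF₁]
      linear_combination (a + 2 - (a + c + k + 2) * t₀) * h2 - 2 * h1
    · simp [massOp, jacobiOp, jacobiF₁]
      linear_combination (a - (a + c + k + 2) * t₀) * h1
  · ext i j
    fin_cases i <;> fin_cases j <;> simp [massOp, jacobiOp, jacobiF₀, massMatrix, Matrix.mul_apply,
      Matrix.conjTranspose_apply, Fin.sum_univ_two]
    · ring
    · linear_combination (k * φ + (a + c - k) + k * (a + 1)) * h1 - (k * (a + 1) * φ + c) * h2
    · linear_combination -(k * φ + (a + c - k) + k * (a + 1)) * h1 + (k * (a + 1) * φ + c) * h2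
    · ring

end

/-! ### Nondegeneracy of the moment recursion and the possible total masses -/

section

variable {a c k t₀ q φ : ℝ}

/-- Eliminating `φ` gives `z (z + p) = c k t₀²`, the cancellation needed for the determinant below.
-/
theorem MassRelations.mul_add_eq (h : MassRelations a c k t₀ q φ) :
    (q - c) * (q - c + ((a + c - k) * t₀ - a)) = c * k * t₀ ^ 2 := by
  linear_combination q * h.add_eq - (a + c + k * t₀) * h.mul_eq

/-- With `σ = n + a + c + k + 2`, the off-diagonal entries are `-k (σ t₀ + a)` and `-c (σ t₀ - a)`.
The determinant is `σ² (z (z + p) - c k t₀²) + k c a²`, whose first term vanishes. -/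
theorem MassRelations.leadingPencil_det (h : MassRelations a c k t₀ q φ) (n : ℕ) :
    ((massOp a c k t₀ q).leadingPencil n).det = ((k * c * a ^ 2 : ℝ) : ℂ) := by
  have h1 : (((q - c) * (q - c + ((a + c - k) * t₀ - a)) : ℝ) : ℂ) = (c * k * t₀ ^ 2 : ℝ) :=
    congrArg _ h.mul_add_eq
  push_cast at h1
  rw [massOp, jacobiOp_leadingPencil, Matrix.det_fin_two]
  simp only [Matrix.map_apply, Matrix.of_apply, Matrix.cons_val', Matrix.cons_val_zero,
    Matrix.cons_val_one, Matrix.cons_val_fin_one]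
  push_cast
  linear_combination ((n : ℂ) + (a + c + k + 2)) ^ 2 * h1

/-- A zero trace means `2 z + p = 0`, so `p² = -4 c k t₀²`. This forces `t₀ = 0`, where `p = -a` is
nonzero. -/
theorem MassRelations.leadingPencil_trace_ne_zero (h : MassRelations a c k t₀ q φ) (ha : 0 < a)
    (hc : 0 < c) (hk : 0 < k) (n : ℕ) : ((massOp a c k t₀ q).leadingPencil n).trace ≠ 0 := by
  have e : ((massOp a c k t₀ q).leadingPencil n).trace =
      ((-(n + (a + c + k + 2)) * (2 * (q - c) + ((a + c - k) * t₀ - a)) : ℝ) : ℂ) := by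
    rw [massOp, jacobiOp_leadingPencil, Matrix.trace_fin_two]
    simp only [Matrix.map_apply, Matrix.of_apply, Matrix.cons_val', Matrix.cons_val_zero,
      Matrix.cons_val_one, Matrix.cons_val_fin_one]
    push_cast
    ring
  rw [e, Complex.ofReal_ne_zero]
  refine mul_ne_zero (neg_ne_zero.2 (by positivity)) fun h0 => ?_
  have h1 : ((a + c - k) * t₀ - a) ^ 2 + 4 * (c * k * t₀ ^ 2) = 0 := by
    rw [← h.mul_add_eq]
    linear_combination (2 * (q - c) + ((a + c - k) * t₀ - a)) * h0
  have h2 : t₀ = 0 := by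
    by_contra ht
    have : 0 < c * k * t₀ ^ 2 := by positivity
    nlinarith [sq_nonneg ((a + c - k) * t₀ - a)]
  subst h2
  simp [ha.ne'] at h1

/-- The right-hand side is positive in the application, so `F₀` is not diagonal and the relation on
the total mass is not void. -/
theorem jacobiF₀_offDiag (z : ℝ) :
    k * jacobiF₀ a c k t₀ ((a + c - k) * t₀ - a) z 1 0 -
      c * jacobiF₀ a c k t₀ ((a + c - k) * t₀ - a) z 0 1 = c * k * (a + c + k + 1) * a := by
  simp [jacobiF₀]
  ring

theorem polyIntegral_one {V : ComplexMeasure ℝ} (hV : HasMoments V) :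
    polyIntegral V 1 = V Set.univ := by
  have := hV.isFiniteMeasure
  simp [polyIntegral]

/-- The total mass of a weight matrix for which an operator with traceless, real and not
diagonal `F₀` is symmetric. -/
theorem IsWeightMatrix.exists_totalMass {U : MatrixMeasure 2} (hU : IsWeightMatrix U)
    {D : DiffOp 2} (hD : D.IsSymmetric U) {A : Matrix (Fin 2) (Fin 2) ℝ}
    (hA : D.F₀ = A.map fun x : ℝ => (x : ℂ)) (hA1 : A 1 1 = -A 0 0)
    (hA2 : A 0 1 ≠ 0 ∨ A 1 0 ≠ 0) :
    ∃ m : Matrix (Fin 2) (Fin 2) ℝ, (∀ i j, polyIntegral (U i j) 1 = (m i j : ℂ)) ∧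
      m 1 0 = m 0 1 ∧ 2 * A 0 0 * m 0 1 + A 0 1 * m 1 1 - A 1 0 * m 0 0 = 0 ∧
      ∀ φ : ℝ, 0 < φ ^ 2 * m 0 0 - 2 * φ * m 0 1 + m 1 1 := by
  have hmom : ∀ i j, HasMoments (U i j) := fun i j n => hU.moments n i j
  set μ := massOf U Set.univ with hμ
  have hμ1 (i j : Fin 2) : polyIntegral (U i j) 1 = μ i j := polyIntegral_one (hmom i j)
  have hinner : innerForm U 1 1 = μ := by
    ext i j
    rw [innerForm_one_right, ← hμ1, Finset.sum_eq_single i]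
    · simp
    · intro l _ hl
      simp [Matrix.one_apply_ne' hl, polyIntegral]
    · simp
  have hpsd : μ.PosSemidef := hU.posSemidef _ MeasurableSet.univ
  have hdet : μ.det ≠ 0 := by
    rw [← hinner]
    refine hU.nonsingular 0 1 (fun i j => ?_) ?_
    · rw [Matrix.one_apply]
      split_ifs <;> simp
    · have : ((1 : MatrixPoly 2).map fun p => p.coeff 0) = 1 := by
        ext i j
        rw [Matrix.map_apply, Matrix.one_apply, Matrix.one_apply]
        split_ifs <;> simp
      simp [this]
  have hpd : μ.PosDef := hpsd.posDef_iff_det_ne_zero.2 hdet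
  -- Symmetry tested on `P = Q = 1`.
  have hcomm : D.F₀ * μ = μ * D.F₀.conjTranspose := by
    ext i j
    have := congrFun₂ (hD 1 1) i j
    rw [innerForm_one_right, innerForm_one_left, D.apply_one] at this
    simp only [Matrix.map_apply, map_C] at this
    have e (V : ComplexMeasure ℝ) (x : ℂ) : polyIntegral V (C x) = x * polyIntegral V 1 := by
      rw [← polyIntegral_C_mul, mul_one]
    simp only [e, hμ1] at this
    rw [Matrix.mul_apply, Matrix.mul_apply, this]
    exact Finset.sum_congr rfl fun l _ => mul_comm _ _
  have hre (i : Fin 2) : ((μ i i).re : ℂ) = μ i i :=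
    Complex.conj_eq_iff_re.1 (hpsd.1.apply i i)
  have hconj : starRingEnd ℂ (μ 0 1) = μ 1 0 := hpsd.1.apply 1 0
  have h00 := congrFun₂ hcomm 0 0
  have h01 := congrFun₂ hcomm 0 1
  have h11 := congrFun₂ hcomm 1 1
  simp only [hA, Matrix.mul_apply, Fin.sum_univ_two, Matrix.conjTranspose_apply, Matrix.map_apply,
    RCLike.star_def, Complex.conj_ofReal, hA1, Complex.ofReal_neg] at h00 h01 h11
  -- The diagonal entries of the commutation relation say that each off-diagonal entry of `F₀`
  -- annihilates `μ₁₀ - μ₀₁`.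
  have hsymm : μ 1 0 = μ 0 1 := by
    rcases hA2 with h | h
    · refine mul_left_cancel₀ (Complex.ofReal_ne_zero.2 h) ?_
      linear_combination h00
    · refine mul_left_cancel₀ (Complex.ofReal_ne_zero.2 h) ?_
      linear_combination -h11
  have hre01 : ((μ 0 1).re : ℂ) = μ 0 1 := Complex.conj_eq_iff_re.1 (hconj.trans hsymm)
  refine ⟨μ.map Complex.re, fun i j => ?_, by simp [hsymm], ?_, fun φ => ?_⟩
  · rw [hμ1]
    fin_cases i <;> fin_cases j
    · exact (hre 0).symm
    · exact hre01.symm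
    · simp [hsymm, hre01]
    · exact (hre 1).symm
  · have : (2 * A 0 0 * μ 0 1 + A 0 1 * μ 1 1 - A 1 0 * μ 0 0 : ℂ) = 0 := by
      linear_combination h01
    rw [← hre 0, ← hre 1, ← hre01] at this
    exact_mod_cast this
  -- The vector `(φ, -1)` is orthogonal to `(1, φ)`, so this form does not see multiples of the
  -- point mass.
  · have := hpd.dotProduct_mulVec_pos (x := ![(φ : ℂ), -1]) (fun h => by
      simpa using congrFun h 1)
    have e : star ![(φ : ℂ), -1] ⬝ᵥ μ.mulVec ![(φ : ℂ), -1] =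
        ((φ ^ 2 * (μ 0 0).re - 2 * φ * (μ 0 1).re + (μ 1 1).re : ℝ) : ℂ) := by
      push_cast
      rw [hre 0, hre 1, hre01]
      simp [dotProduct, Matrix.mulVec, Fin.sum_univ_two, hsymm]
      ring
    rw [e] at this
    exact_mod_cast this

/-- Solutions of a linear relation which is satisfied by `(1, φ, φ²)`. -/
theorem exists_eq_combination {f f₁ f₂ φ : ℝ} (hf : f₁ ≠ 0 ∨ f₂ ≠ 0)
    (hφ : f₁ * φ ^ 2 + 2 * f * φ - f₂ = 0) {S₀ S₁ S₂ x y g : ℝ}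
    (hS : 2 * f * S₁ + f₁ * S₂ - f₂ * S₀ = 0) (hx : 2 * f * y + f₁ * g - f₂ * x = 0)
    (hSpos : 0 < φ ^ 2 * S₀ - 2 * φ * S₁ + S₂) (hxpos : 0 < φ ^ 2 * x - 2 * φ * y + g) :
    ∃ γ ζ : ℝ, 0 < γ ∧ x = γ * S₀ + ζ ∧ y = γ * S₁ + ζ * φ ∧ g = γ * S₂ + ζ * φ ^ 2 := by
  set L := φ ^ 2 * S₀ - 2 * φ * S₁ + S₂ with hL
  -- The form `φ² x - 2 φ y + g` vanishes at `(1, φ, φ²)`, which dictates `γ` and makes it positive.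
  set γ := (φ ^ 2 * x - 2 * φ * y + g) / L with hγ
  have hγL : γ * L = φ ^ 2 * x - 2 * φ * y + g := div_mul_cancel₀ _ hSpos.ne'
  -- If `φ` were a critical root of the quadratic, the linear relation would be `f₁` times the form
  -- `L`, contradicting `L > 0` unless all coefficients vanish.
  have hne : f + φ * f₁ ≠ 0 := by
    intro h0
    have h1 : f₁ * L = 0 := by
      rw [hL]
      linear_combination hS - S₀ * hφ - 2 * (S₁ - φ * S₀) * h0
    have h2 : f₁ = 0 := (mul_eq_zero.1 h1).resolve_right hSpos.ne'
    have h3 : f = 0 := by simpa [h2] using h0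
    rcases hf with hf | hf
    · exact hf h2
    · exact hf (by simpa [h2, h3] using hφ)
  have hy : y - γ * S₁ = φ * (x - γ * S₀) := by
    refine sub_eq_zero.1 ((mul_eq_zero.1 (?_ : (f + φ * f₁) * _ = 0)).resolve_left hne)
    rw [hL] at hγL
    linear_combination (1 / 2) * hx - (1 / 2) * γ * hS + (1 / 2) * f₁ * hγL
      - (1 / 2) * (x - γ * S₀) * hφ
  refine ⟨γ, x - γ * S₀, div_pos hxpos hSpos, by ring, by linear_combination hy, ?_⟩
  rw [hL] at hγL
  linear_combination -hγL + 2 * φ * hy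

end

/-! ### Determination of `Υ(D)` and existence of the mass -/

section

variable {α β k t₀ q φ : ℝ}

theorem isWeightMatrix_jacobiWeight (hα : -1 < α) (hβ : -1 < β) (hk : 0 < k) (hkβ : k < β + 1) :
    IsWeightMatrix (jacobiWeight α β k) := by
  have := isWeightMatrix_combination hα hβ hk hkβ 0 one_pos le_rfl
    (Matrix.PosSemidef.zero (n := Fin 2) (R := ℂ))
  have e : (1 : ℝ) • jacobiWeight α β k + (0 : ℝ) • pointMass 0 0 = jacobiWeight α β k := by
    refine Matrix.ext fun i j => VectorMeasure.ext fun s _ => ?_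
    change (1 : ℝ) • jacobiWeight α β k i j s + (0 : ℝ) • pointMass 0 0 i j s = _
    rw [one_smul, zero_smul, add_zero]
  rwa [e] at this

theorem massOf_jacobiWeight_singleton (hα : -1 < α) (hβ : -1 < β) (t : ℝ) :
    massOf (jacobiWeight α β k) {t} = 0 := by
  ext i j
  rw [massOf, Matrix.of_apply, jacobiWeight_apply,
    withDensityᵥ_apply (jacobiWeight_integrable_density hα hβ i j) (measurableSet_singleton t),
    Matrix.zero_apply]
  exact setIntegral_measure_zero _
    (le_antisymm ((Measure.restrict_le_self _).trans_eq Real.volume_singleton) zero_le)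

theorem DiffOp.IsSymmetric.combination {D : DiffOp 2} (hα : -1 < α) (hβ : -1 < β)
    (hJ : D.IsSymmetric (jacobiWeight α β k)) {M : Matrix (Fin 2) (Fin 2) ℂ} (hM : M.PosSemidef)
    (h : MassConstraints D t₀ M) (γ ζ : ℝ) :
    D.IsSymmetric (γ • jacobiWeight α β k + ζ • pointMass t₀ M) :=
  (hJ.smul γ).add (fun i j => (jacobiWeight_hasMoments hα hβ i j).smul γ)
    (fun i j => (pointMass_hasMoments t₀ M i j).smul ζ) ((h.isSymmetric hM.1).smul ζ)

theorem MassRelations.upsilon_eq (hα : -1 < α) (hβ : -1 < β) (hk : 0 < k) (hkβ : k < β + 1)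
    (h : MassRelations (α + 1) (β - k + 1) k t₀ q φ) :
    Upsilon (massOp (α + 1) (β - k + 1) k t₀ q) =
      {U | ∃ γ ζ : ℝ, 0 < γ ∧ 0 ≤ ζ ∧
        U = γ • jacobiWeight α β k + ζ • pointMass t₀ (massMatrix φ)} := by
  have ha : 0 < α + 1 := by linarith
  have hc : 0 < β - k + 1 := by linarith
  set D := massOp (α + 1) (β - k + 1) k t₀ q with hD
  have hDreal : D.IsReal := jacobiOp_isReal _ _ _ _ _ _
  have hJ : D.IsSymmetric (jacobiWeight α β k) := jacobiOp_isSymmetric hα hβ _ _ _ _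
  have hsym := hJ.combination hα hβ (massMatrix_posSemidef φ) h.massConstraints
  ext U
  refine ⟨fun ⟨hU, hDU⟩ => ?_, ?_⟩
  · set A := jacobiF₀ (α + 1) (β - k + 1) k t₀ ((α + 1 + (β - k + 1) - k) * t₀ - (α + 1))
      (q - (β - k + 1)) with hA
    have hA0 : D.F₀ = A.map fun x : ℝ => (x : ℂ) := rfl
    have hA1 : A 1 1 = -A 0 0 := rfl
    have hA2 : A 0 1 ≠ 0 ∨ A 1 0 ≠ 0 := by
      by_contra! hcon
      have := jacobiF₀_offDiag (a := α + 1) (c := β - k + 1) (k := k) (t₀ := t₀)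
        (q - (β - k + 1))
      rw [← hA, hcon.1, hcon.2] at this
      have h2 : 0 < (β - k + 1) * k * (α + 1 + (β - k + 1) + k + 1) * (α + 1) := by positivity
      linarith
    -- The off-diagonal entry of `F₀ M = M F₀*` says that `(1, φ, φ²)` satisfies the linear relation
    -- on total masses.
    have hφ : A 0 1 * φ ^ 2 + 2 * A 0 0 * φ - A 1 0 = 0 := by
      have := congrFun₂ h.massConstraints.2.2 0 1
      rw [← hD, hA0] at this
      simp only [Matrix.mul_apply, Fin.sum_univ_two, massMatrix, Matrix.conjTranspose_apply,
        Matrix.map_apply, RCLike.star_def, Complex.conj_ofReal, hA1, Matrix.of_apply,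
        Matrix.cons_val', Matrix.cons_val_zero, Matrix.cons_val_one, Matrix.cons_val_fin_one]
        at this
      have e : A 0 0 * φ + A 0 1 * φ ^ 2 = 1 * A 1 0 + φ * -A 0 0 := by exact_mod_cast this
      linear_combination e
    obtain ⟨S, hS, hS10, hSrel, hSpos⟩ := (isWeightMatrix_jacobiWeight hα hβ hk
      hkβ).exists_totalMass hJ hA0 hA1 hA2
    obtain ⟨m, hm, hm10, hmrel, hmpos⟩ := hU.exists_totalMass hDU hA0 hA1 hA2
    obtain ⟨γ, ζ, hγ, e00, e01, e11⟩ := exists_eq_combination hA2 hφ hSrel hmrel (hSpos φ)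
      (hmpos φ)
    set V := γ • jacobiWeight α β k + ζ • pointMass t₀ (massMatrix φ) with hV
    have hVmom := combination_hasMoments (k := k) hα hβ t₀ γ ζ (massMatrix φ)
    have hUmom : ∀ i j, HasMoments (U i j) := fun i j n => hU.moments n i j
    have hzero : ∀ i j, polyIntegral ((U - V) i j) 1 = 0 := by
      intro i j
      have e := polyIntegral_combination (k := k) hα hβ t₀ γ ζ (massMatrix φ) i j 1
      rw [← hV, hS] at e
      have e2 : polyIntegral ((U - V) i j) 1 = polyIntegral (U i j) 1 - polyIntegral (V i j) 1 :=
        polyIntegral_sub_measure (hUmom i j) (hVmom i j) 1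
      rw [e2, e, hm, eval_one, one_mul, sub_eq_zero]
      fin_cases i <;> fin_cases j
      · simp [massMatrix, e00]
      · simp [massMatrix, e01]
      · simp [massMatrix, hm10, hS10, e01]
      · simp [massMatrix, e11]
    have hpoly (i j : Fin 2) (p : ℂ[X]) : polyIntegral (U i j) p = polyIntegral (V i j) p := by
      have := (hDU.sub hUmom hVmom (hsym γ ζ)).polyIntegral_eq_zero hDreal
        (fun i j => (hUmom i j).sub (hVmom i j)) (h.leadingPencil_trace_ne_zero ha hc hk)
        (fun n => by
          rw [hD, h.leadingPencil_det, Complex.ofReal_ne_zero]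
          positivity) hzero i j p
      rw [← sub_eq_zero, ← polyIntegral_sub_measure (hUmom i j) (hVmom i j)]
      exact this
    have hUV : U = V := hU.eq_of_polyIntegral_eq hVmom (R := |t₀| + 2) (by positivity)
      (combination_variation_eq_zero hα hβ t₀ γ ζ _) hpoly
    refine ⟨γ, ζ, hγ, ?_, hUV⟩
    -- The Jacobi part has no atoms and `M₀₀ = 1`, so the mass at `t₀` has upper left entry `ζ`.
    have hpos := (hU.posSemidef {t₀} (measurableSet_singleton t₀)).diag_nonneg (i := 0)
    have e : massOf U {t₀} = γ • massOf (jacobiWeight α β k) {t₀} +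
        ζ • massOf (pointMass t₀ (massMatrix φ)) {t₀} := by rw [hUV]; rfl
    have e2 : massOf U {t₀} 0 0 = ζ := by
      rw [e, massOf_jacobiWeight_singleton hα hβ]
      simp [massOf, pointMass, massMatrix, VectorMeasure.dirac_apply_of_mem]
    rw [e2] at hpos
    exact_mod_cast hpos
  · rintro ⟨γ, ζ, hγ, hζ, rfl⟩
    exact ⟨isWeightMatrix_combination hα hβ hk hkβ t₀ hγ hζ (massMatrix_posSemidef φ), hsym γ ζ⟩

theorem massOp_F₂_ne_zero {a c : ℝ} (ha : a ≠ 0) (hc : c ≠ 0) :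
    (massOp a c k t₀ q).F₂ ≠ 0 := by
  intro h
  have h01 := congrFun₂ h 0 1
  have e : (massOp a c k t₀ q).F₂ 0 1 = C (c * t₀ : ℂ)
      + C (-((a + c - k) * t₀ - a) : ℂ) * X + C (-(t₀ * k) : ℂ) * X ^ 2 := by
    simp [massOp, jacobiOp, jacobiF₂]
    ring
  rw [e, Matrix.zero_apply] at h01
  have h0 : t₀ = 0 := by
    have := congrArg (eval 0) h01
    simpa [hc] using this
  subst h0
  have h1 := congrArg (eval 1) h01
  simp [ha] at h1

/-- Eliminating `q` leaves `A φ² + B φ + c (1 - t₀) = 0`. Multiplied by `(c + k)²`, its discriminant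
is a square plus a nonnegative multiple of `(1 - t₀)²`. -/
theorem exists_massRelations {a c : ℝ} (ha : 0 < a) (hc : 0 < c) (hk : 0 < k)
    (hA : a + c + k * t₀ ≠ 0) : ∃ q φ, MassRelations a c k t₀ q φ := by
  set A := a + c + k * t₀ with hAdef
  set B := (a + c - k) * t₀ - a - 2 * c with hB
  have hdisc : 0 ≤ discrim A B (c * (1 - t₀)) := by
    have e : (c + k) ^ 2 * discrim A B (c * (1 - t₀)) =
        ((c + k) ^ 2 + (2 * k * a - (c + k) * (a + (c + k))) * (1 - t₀)) ^ 2 +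
          4 * k * a ^ 2 * c * (1 - t₀) ^ 2 := by
      rw [discrim, hAdef, hB]
      ring
    refine (mul_nonneg_iff_of_pos_left (by positivity : 0 < (c + k) ^ 2)).1 ?_
    rw [e]
    positivity
  obtain ⟨φ, hφ⟩ := exists_quadratic_eq_zero hA ⟨√(discrim A B (c * (1 - t₀))),
    (Real.mul_self_sqrt hdisc).symm⟩
  exact ⟨-A * φ - B, φ, by linear_combination -hφ, by ring⟩

end

/-! ### The explicit operator for `α = β = 0`, `k = 1/2` -/

section

variable {ε t₀ : ℝ}

/-- Here `a = 1` and `c = 1/2`, and `phi` is the quadratic formula for the eliminated equation. The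
explicit operator is twice `massOp`, hence the half of `quot`. -/
theorem massRelations_phi_quot (hε : ε = 1 ∨ ε = -1) (ht : t₀ ≠ -3) :
    MassRelations (0 + 1) (0 - 1 / 2 + 1) (1 / 2) t₀ (quot ε t₀ / 2) (phi ε t₀) := by
  have ht' : t₀ + 3 ≠ 0 := fun h => ht (by linarith)
  have hε2 : ε ^ 2 = 1 := by rcases hε with rfl | rfl <;> norm_num
  have hr : √(2 * t₀ ^ 2 - 2 * t₀ + 1) ^ 2 = 2 * t₀ ^ 2 - 2 * t₀ + 1 :=
    Real.sq_sqrt (by nlinarith [sq_nonneg (t₀ - 1)])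
  have hφ : phi ε t₀ * (t₀ + 3) = 2 - t₀ + ε * √(2 * t₀ ^ 2 - 2 * t₀ + 1) :=
    div_mul_cancel₀ _ ht'
  have hmul : phi ε t₀ * (4 - 2 * t₀ - phi ε t₀ * (t₀ + 3)) = 1 - t₀ := by
    refine mul_left_cancel₀ ht' ?_
    rw [← mul_assoc, mul_comm (t₀ + 3), hφ]
    linear_combination -√(2 * t₀ ^ 2 - 2 * t₀ + 1) ^ 2 * hε2 - hr
  have hq : quot ε t₀ = 4 - 2 * t₀ - phi ε t₀ * (t₀ + 3) := by
    -- When `φ = 0` the quadratic forces `t₀ = 1`, and `4 - 2 t₀` is the default value `2`.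
    by_cases h : phi ε t₀ = 0
    · rw [h, zero_mul] at hmul
      rw [quot, if_pos h, h]
      linarith
    · rw [quot, if_neg h, div_eq_iff h, ← hmul, mul_comm]
  exact ⟨by rw [hq]; linear_combination (1 / 2) * hmul, by rw [hq]; ring⟩

/-- The operator `D'` is `r` times the operator `D`. -/
structure DiffOp.IsMultiple (D' : DiffOp 2) (r : ℝ) (D : DiffOp 2) : Prop where
  F₂_eq : D'.F₂ = C (r : ℂ) • D.F₂
  F₁_eq : D'.F₁ = C (r : ℂ) • D.F₁
  F₀_eq : D'.F₀ = (r : ℂ) • D.F₀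

namespace DiffOp.IsMultiple

variable {D D' : DiffOp 2} {r : ℝ}

theorem apply_eq (h : D'.IsMultiple r D) (P : MatrixPoly 2) :
    D'.apply P = C (r : ℂ) • D.apply P := by
  have h0 : ((r : ℂ) • D.F₀).map C = C (r : ℂ) • D.F₀.map C :=
    Matrix.ext fun i j => by simp
  rw [DiffOp.apply, DiffOp.apply, h.F₂_eq, h.F₁_eq, h.F₀_eq, h0]
  simp only [Matrix.mul_smul, smul_add]

theorem isReal (h : D'.IsMultiple r D) (hD : D.IsReal) : D'.IsReal := by
  intro i j
  obtain ⟨h2, h1, h0⟩ := hD i j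
  rw [h.F₂_eq, h.F₁_eq, h.F₀_eq]
  simp [h2, h1, h0]

theorem massConstraints (h : D'.IsMultiple r D) {M : Matrix (Fin 2) (Fin 2) ℂ}
    (hM : MassConstraints D t₀ M) : MassConstraints D' t₀ M := by
  have e (F : MatrixPoly 2) : (C (r : ℂ) • F).map (fun p => p.eval (t₀ : ℂ)) =
      (r : ℂ) • F.map fun p => p.eval (t₀ : ℂ) := Matrix.ext fun i j => by simp
  obtain ⟨h2, h1, h0⟩ := hM
  refine ⟨?_, ?_, ?_⟩
  · rw [h.F₂_eq, e, Matrix.smul_mul, h2, smul_zero]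
  · rw [h.F₁_eq, e, Matrix.smul_mul, h1, smul_zero]
  · rw [h.F₀_eq, Matrix.smul_mul, h0, Matrix.conjTranspose_smul, Matrix.mul_smul]
    simp

theorem F₂_ne_zero (h : D'.IsMultiple r D) (hr : r ≠ 0) (hD : D.F₂ ≠ 0) : D'.F₂ ≠ 0 := by
  rw [h.F₂_eq]
  exact smul_ne_zero (by simpa using hr) hD

theorem upsilon_eq (h : D'.IsMultiple r D) (hr : r ≠ 0) : Upsilon D' = Upsilon D :=
  Set.ext fun _ => and_congr_right fun _ => isSymmetric_iff_of_apply_eq hr h.apply_eq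

end DiffOp.IsMultiple

theorem explicitOp_isMultiple (hε : ε = 1 ∨ ε = -1) (ht : t₀ ≠ -3) :
    (explicitOp ε t₀).IsMultiple 2
      (massOp (0 + 1) (0 - 1 / 2 + 1) (1 / 2) t₀ (quot ε t₀ / 2)) := by
  have h := massRelations_phi_quot hε ht
  have h1 := h.mul_eq
  have h2 := h.add_eq
  refine ⟨?_, ?_, ?_⟩
  · refine Matrix.ext fun i j => Polynomial.funext fun x => ?_
    fin_cases i <;> fin_cases j <;>
      simp [explicitOp, explicitF₂, massOp, jacobiOp, jacobiF₂] <;> ring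
  · refine Matrix.ext fun i j => Polynomial.funext fun x => ?_
    fin_cases i <;> fin_cases j <;>
      simp [explicitOp, explicitF₁, massOp, jacobiOp, jacobiF₁] <;> ring
  · have e : (!![quot ε t₀ * (1 + 2 * phi ε t₀) / 2, -t₀ - 3 + quot ε t₀ / 2;
      -t₀ + quot ε t₀ / 2, -(quot ε t₀ * (1 + 2 * phi ε t₀) / 2)] : Matrix (Fin 2) (Fin 2) ℝ) =
      (2 : ℝ) • jacobiF₀ (0 + 1) (0 - 1 / 2 + 1) (1 / 2) t₀
        ((0 + 1 + (0 - 1 / 2 + 1) - 1 / 2) * t₀ - (0 + 1))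
        (quot ε t₀ / 2 - (0 - 1 / 2 + 1)) := by
      ext i j
      fin_cases i <;> fin_cases j
      -- Only the diagonal of `F₀` needs the relation `q φ = c (1 - t₀)`, being written with `φ`
      -- instead of `t₀`.
      · simp [jacobiF₀]
        linear_combination 2 * h1
      · simp [jacobiF₀]; ring
      · simp [jacobiF₀]; ring
      · simp [jacobiF₀]
        linear_combination -2 * h1
    refine Matrix.ext fun i j => (congrArg Complex.ofReal (congrFun₂ e i j)).trans ?_
    simp [massOp, jacobiOp]

/-- All properties of a multiple of the operator `massOp` with respect to the Jacobi weight
matrix. -/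
theorem MassRelations.main {α β k q φ r : ℝ} (hα : -1 < α) (hβ : -1 < β) (hk : 0 < k)
    (hkβ : k < β + 1) (h : MassRelations (α + 1) (β - k + 1) k t₀ q φ) (hr : r ≠ 0)
    {D : DiffOp 2} (hD : D.IsMultiple r (massOp (α + 1) (β - k + 1) k t₀ q)) :
    D.F₂ ≠ 0 ∧ D.IsReal ∧ (∀ i j, (massMatrix φ i j).im = 0) ∧
      (massMatrix φ).PosSemidef ∧ (massMatrix φ).rank = 1 ∧
      D.IsSymmetric (jacobiWeight α β k) ∧ MassConstraints D t₀ (massMatrix φ) ∧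
      (∀ γ ζ : ℝ, 0 < γ → 0 ≤ ζ →
        D.IsSymmetric (γ • jacobiWeight α β k + ζ • pointMass t₀ (massMatrix φ))) ∧
      Upsilon D = {U | ∃ γ ζ : ℝ, 0 < γ ∧ 0 ≤ ζ ∧
        U = γ • jacobiWeight α β k + ζ • pointMass t₀ (massMatrix φ)} := by
  have hM := massMatrix_posSemidef φ
  have hJ : D.IsSymmetric (jacobiWeight α β k) :=
    (isSymmetric_iff_of_apply_eq hr hD.apply_eq).2 (jacobiOp_isSymmetric hα hβ _ _ _ _)
  have hcon := hD.massConstraints h.massConstraints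
  refine ⟨hD.F₂_ne_zero hr (massOp_F₂_ne_zero (by linarith : 0 < α + 1).ne'
    (by linarith : 0 < β - k + 1).ne'), hD.isReal (jacobiOp_isReal _ _ _ _ _ _),
    fun i j => Complex.ofReal_im _, hM, massMatrix_rank φ, hJ, hcon,
    fun γ ζ _ _ => hJ.combination hα hβ hM hcon γ ζ, ?_⟩
  rw [hD.upsilon_eq hr, h.upsilon_eq hα hβ hk hkβ]

end

end MatrixWeight

end

theorem mainTheorem5 :
    (∀ α β k t₀ : ℝ, -1 < α → -1 < β → 0 < k → k < β + 1 →
      t₀ ≠ -(1 / k) * (α + β - k + 2) →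
      ∃ (D : MatrixWeight.DiffOp 2) (M : Matrix (Fin 2) (Fin 2) ℂ),
        D.F₂ ≠ 0 ∧ D.IsReal ∧ (∀ i j, (M i j).im = 0) ∧
        M.PosSemidef ∧ M.rank = 1 ∧
        D.IsSymmetric (MatrixWeight.jacobiWeight α β k) ∧
        MatrixWeight.MassConstraints D t₀ M ∧
        (∀ γ ζ : ℝ, 0 < γ → 0 ≤ ζ →
          D.IsSymmetric
            (γ • MatrixWeight.jacobiWeight α β k + ζ • MatrixWeight.pointMass t₀ M)) ∧
        MatrixWeight.Upsilon D =
          {U | ∃ γ ζ : ℝ, 0 < γ ∧ 0 ≤ ζ ∧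
            U = γ • MatrixWeight.jacobiWeight α β k + ζ • MatrixWeight.pointMass t₀ M}) ∧
    (∀ ε t₀ : ℝ, ε = 1 ∨ ε = -1 → t₀ ≠ -3 →
      (MatrixWeight.explicitOp ε t₀).F₂ ≠ 0 ∧ (MatrixWeight.explicitOp ε t₀).IsReal ∧
      (∀ i j, (MatrixWeight.explicitM ε t₀ i j).im = 0) ∧
      (MatrixWeight.explicitM ε t₀).PosSemidef ∧ (MatrixWeight.explicitM ε t₀).rank = 1 ∧
      (MatrixWeight.explicitOp ε t₀).IsSymmetric (MatrixWeight.jacobiWeight 0 0 (1 / 2)) ∧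
      MatrixWeight.MassConstraints (MatrixWeight.explicitOp ε t₀) t₀
        (MatrixWeight.explicitM ε t₀) ∧
      (∀ γ ζ : ℝ, 0 < γ → 0 ≤ ζ →
        (MatrixWeight.explicitOp ε t₀).IsSymmetric
          (γ • MatrixWeight.jacobiWeight 0 0 (1 / 2) +
            ζ • MatrixWeight.pointMass t₀ (MatrixWeight.explicitM ε t₀))) ∧
      MatrixWeight.Upsilon (MatrixWeight.explicitOp ε t₀) =
        {U | ∃ γ ζ : ℝ, 0 < γ ∧ 0 ≤ ζ ∧
          U = γ • MatrixWeight.jacobiWeight 0 0 (1 / 2) +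
            ζ • MatrixWeight.pointMass t₀ (MatrixWeight.explicitM ε t₀)}) := by
  refine ⟨fun α β k t₀ hα hβ hk hkβ ht => ?_, fun ε t₀ hε ht => ?_⟩
  -- The excluded `t₀` is exactly the zero of the leading coefficient of the quadratic for `φ`.
  · have hA : α + 1 + (β - k + 1) + k * t₀ ≠ 0 := by
      contrapose! ht
      field_simp
      linarith
    obtain ⟨q, φ, h⟩ := MatrixWeight.exists_massRelations (by linarith) (by linarith) hk hA
    exact ⟨MatrixWeight.massOp (α + 1) (β - k + 1) k t₀ q, _, h.main hα hβ hk hkβ one_ne_zero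
      ⟨by simp, by simp, by simp⟩⟩
  · exact (MatrixWeight.massRelations_phi_quot hε ht).main (by norm_num) (by norm_num) (by norm_num)
      (by norm_num) two_ne_zero (MatrixWeight.explicitOp_isMultiple hε ht)
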